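/- Let $d \ge 1$ and let $\mathbb{Z}^d$ be the square lattice, in which two vertices are joined by an edge if and only if their $\ell^1$-distance is $1$. Let $(t(e))_e$, indexed by the edges $e$ of $\mathbb{Z}^d$, be independent (not necessarily identically distributed) real random variables on a probability space, the passage times of the edges. For a finite self-avoiding path $\pi$ put $T(\pi)=\sum_{e\in\pi}t(e)$, and for $n\ge 1$ let $$T_n=\inf_{\pi}T(\pi),$$ the infimum being over all finite self-avoiding paths $\pi$ with endvertices the origin and $(n,0,\ldots,0)$. Consider the conditions - (i) $\sup_e \mathbb{P}(t(e)<\epsilon)\to 0$ as $\epsilon\downarrow 0$; - (ii) $\sup_e \mathbb{E}\,t(e)^2<\infty$; - (ii)(a) $\sup_e \mathbb{E}\big[t(e)^2\,\mathbf{1}(t(e)\ge M)\big]\to 0$ as $M\to\infty$; - (ii)(b) $\sup_e \mathbb{E}\,t(e)^p<\infty$ for some real $p>2$. (Condition (i) implies that $t(e)>0$ almost surely for every $e$.) Then the following hold. 1. If (i) and (ii) hold, then each $T_n$ is integrable and $\frac1n(T_n-\mathbb{E}T_n)\to 0$ almost surely and in $L^1$ as $n\to\infty$. 2. If (i) and (ii)(a)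 hold, then each $T_n$ is square integrable and $\frac1n(T_n-\mathbb{E}T_n)\to 0$ almost surely and in $L^2$. 3. If (i) and (ii)(b) hold, then each $T_n$ is square integrable, $\frac1n(T_n-\mathbb{E}T_n)\to 0$ almost surely and in $L^2$, and there is a constant $C>0$ with $\operatorname{var}(T_n)\le Cn$ for all $n\ge 1$. In each of the three cases there are constants $0<\eta_1\le\eta_2<\infty$ such that $$\eta_1\le\liminf_{n\to\infty}\frac{T_n}{n}\le\limsup_{n\to\infty}\frac{T_n}{n}\le\eta_2\quad\text{almost surely.}$$ -/

import Mathlib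

open MeasureTheory ProbabilityTheory Filter Topology
open scoped ENNReal

namespace FPP

/-- The square lattice `ℤ^d`: two vertices are adjacent iff their `ℓ¹`-distance is `1`. -/
def lattice (d : ℕ) : SimpleGraph (Fin d → ℤ) where
  Adj x y := ∑ i, |x i - y i| = 1
  symm := ⟨fun x y h => by simpa only [abs_sub_comm] using h⟩
  loopless := ⟨fun x h => by simp at h⟩

/-- The edges of `ℤ^d`. -/
abbrev Edge (d : ℕ) : Type := (lattice d).edgeSet

/-- The point `(n, 0, …, 0)`. -/
def axisPoint (d : ℕ) [NeZero d] (n : ℕ) : Fin d → ℤ := Pi.single 0 (n : ℤ)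

/-- The passage time of a walk for the edge weights `τ`: the sum of the weights of the edges
traversed. (For a self-avoiding path each edge occurs once.) -/
noncomputable def walkTime {d : ℕ} (τ : Edge d → ℝ) {x y : Fin d → ℤ}
    (w : (lattice d).Walk x y) : ℝ :=
  (w.darts.map fun a => τ ⟨a.edge, a.edge_mem⟩).sum

/-- The minimum passage time `T_n`: the infimum of the passage times of all finite self-avoiding
paths from the origin to `(n, 0, …, 0)`. -/
noncomputable def minTime {d : ℕ} [NeZero d] {Ω : Type*} (t : Edge d → Ω → ℝ) (n : ℕ) (ω : Ω) :
    ℝ :=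
  ⨅ π : (lattice d).Path 0 (axisPoint d n), walkTime (fun e => t e ω) π.1

section Conditions

variable {d : ℕ} {Ω : Type*} [MeasurableSpace Ω]

/-- `sup_e P(t(e) < ε) → 0` as `ε ↓ 0`. -/
def NoMassNearZero (P : Measure Ω) (t : Edge d → Ω → ℝ) : Prop :=
  Tendsto (fun ε : ℝ => ⨆ e, P {ω | t e ω < ε}) (𝓝[>] 0) (𝓝 0)

/-- `sup_e E t(e)² < ∞`. -/
def BoundedSecondMoments (P : Measure Ω) (t : Edge d → Ω → ℝ) : Prop :=
  (⨆ e, ∫⁻ ω, ENNReal.ofReal (t e ω ^ 2) ∂P) < ∞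

/-- `sup_e E [t(e)² 1(t(e) ≥ M)] → 0` as `M → ∞`. -/
def UnifIntegrableSquares (P : Measure Ω) (t : Edge d → Ω → ℝ) : Prop :=
  Tendsto (fun M : ℝ => ⨆ e, ∫⁻ ω in {ω | M ≤ t e ω}, ENNReal.ofReal (t e ω ^ 2) ∂P)
    atTop (𝓝 0)

/-- `sup_e E t(e)^p < ∞` for some real `p > 2`. -/
def BoundedHigherMoments (P : Measure Ω) (t : Edge d → Ω → ℝ) : Prop :=
  ∃ p : ℝ, 2 < p ∧ (⨆ e, ∫⁻ ω, ENNReal.ofReal (t e ω ^ p) ∂P) < ∞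

end Conditions

section Conclusions

variable {d : ℕ} [NeZero d] {Ω : Type*} [MeasurableSpace Ω]

/-- `(T_n - E T_n) / n`. -/
noncomputable def centredTime (P : Measure Ω) (t : Edge d → Ω → ℝ) (n : ℕ) (ω : Ω) : ℝ :=
  (minTime t n ω - ∫ ω', minTime t n ω' ∂P) / n

/-- `(T_n - E T_n) / n → 0` almost surely. -/
def ConvergesAS (P : Measure Ω) (t : Edge d → Ω → ℝ) : Prop :=
  ∀ᵐ ω ∂P, Tendsto (fun n => centredTime P t n ω) atTop (𝓝 0)

/-- Every `T_n` is in `L^q`, and `(T_n - E T_n) / n → 0` in `L^q`. -/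
def ConvergesInLp (q : ℝ≥0∞) (P : Measure Ω) (t : Edge d → Ω → ℝ) : Prop :=
  (∀ n, MemLp (minTime t n) q P) ∧
    Tendsto (fun n => eLpNorm (centredTime P t n) q P) atTop (𝓝 0)

/-- There are constants `0 < η₁ ≤ η₂ < ∞` with `η₁ ≤ liminf T_n/n ≤ limsup T_n/n ≤ η₂` almost
surely; the limits are taken in the extended reals. -/
def NontrivialGrowth (P : Measure Ω) (t : Edge d → Ω → ℝ) : Prop :=
  ∃ η₁ η₂ : ℝ, 0 < η₁ ∧ η₁ ≤ η₂ ∧ ∀ᵐ ω ∂P,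
    (η₁ : EReal) ≤ liminf (fun n : ℕ => ((minTime t n ω / n : ℝ) : EReal)) atTop ∧
    liminf (fun n : ℕ => ((minTime t n ω / n : ℝ) : EReal)) atTop ≤
      limsup (fun n : ℕ => ((minTime t n ω / n : ℝ) : EReal)) atTop ∧
    limsup (fun n : ℕ => ((minTime t n ω / n : ℝ) : EReal)) atTop ≤ (η₂ : EReal)

/-- `var(T_n) ≤ C n` for some constant `C > 0` and all `n ≥ 1`. -/
def LinearVariance (P : Measure Ω) (t : Edge d → Ω → ℝ) : Prop :=
  ∃ C : ℝ, 0 < C ∧ ∀ n : ℕ, 1 ≤ n → variance (minTime t n) P ≤ C * n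

end Conclusions

end FPP

/-! The core is the bound var(T_n) = O(n), which needs only (i) and (ii). A one-sided Efron–Stein
inequality (`variance_le_sum_integral_sq_posPart`) bounds the variance by the expected squared
increases of T_n when single edges are resampled. Resampling raises a minimum only at an edge lying
in every minimising path, and then by at most the new passage time. That time is independent of the
old configuration, so only its second moment enters, and var(T_n) is at most K times the expected
length of a minimiser.

Lengths are controlled by a Peierls argument: (i) makes the Laplace transforms uniformly small, so a
path of k edges is fast with probability beating the exponential number of paths. Hence length ≤ T/a
+ R with R integrable (`exists_length_le_walkTime_div_add`). Comparison with the straight path along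
the axis makes the expected length O(n).

The linear variance gives L² convergence at once, and almost sure convergence along n = k²; the
passage time of a short axis segment fills the gaps between squares. The same length bound gives the
lower growth constant, and the straight path gives the upper one. Under (i) times are almost surely
nonnegative, and each of (ii)(a), (ii)(b) implies (ii), so one theorem serves all three cases. -/

namespace FPP

/-! ### One-sided Efron–Stein inequality on finite product spaces -/

section EfronStein

variable {ι α : Type*} [DecidableEq ι]

/-- Exchange the coordinates in `A` between the two configurations of a pair. -/
def exchange (A : Finset ι) (z : (ι → α) × (ι → α)) : (ι → α) × (ι → α) :=
  (A.piecewise z.2 z.1, A.piecewise z.1 z.2)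

lemma exchange_empty (z : (ι → α) × (ι → α)) : exchange ∅ z = z := by
  simp [exchange]

lemma exchange_singleton_exchange {A : Finset ι} {k : ι} (hk : k ∉ A)
    (z : (ι → α) × (ι → α)) : exchange {k} (exchange A z) = exchange (insert k A) z := by
  ext i <;> by_cases hi : i = k <;> by_cases hA : i ∈ A <;>
    simp_all [exchange, Finset.piecewise]

lemma exchange_exchange_singleton {A : Finset ι} {k : ι} (hk : k ∉ A)
    (z : (ι → α) × (ι → α)) : exchange A (exchange {k} z) = exchange (insert k A) z := by
  ext i <;> by_cases hi : i = k <;> by_cases hA : i ∈ A <;>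
    simp_all [exchange, Finset.piecewise]

lemma exchange_exchange (A : Finset ι) (z : (ι → α) × (ι → α)) :
    exchange A (exchange A z) = z := by
  ext i <;> by_cases hA : i ∈ A <;> simp_all [exchange, Finset.piecewise]

variable [Fintype ι] [MeasurableSpace α]

/-- A pair of configurations is a configuration of independent exchangeable pairs, and swapping any
of these pairs preserves the law. -/
lemma measurePreserving_exchange (μ : ι → Measure α) [∀ i, IsProbabilityMeasure (μ i)]
    (A : Finset ι) :
    MeasurePreserving (exchange A) ((Measure.pi μ).prod (Measure.pi μ))
      ((Measure.pi μ).prod (Measure.pi μ)) := by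
  have h1 := measurePreserving_arrowProdEquivProdArrow α α ι μ μ
  have h2 : MeasurePreserving
      (fun (p : ι → α × α) i => (if i ∈ A then Prod.swap else id) (p i))
      (Measure.pi fun i => (μ i).prod (μ i)) (Measure.pi fun i => (μ i).prod (μ i)) := by
    refine measurePreserving_pi _ _ fun i => ?_
    by_cases hi : i ∈ A
    · simpa [hi] using Measure.measurePreserving_swap
    · simpa [hi] using MeasurePreserving.id _
  convert h1.comp (h2.comp h1.symm) using 1
  ext z i
  · by_cases hi : i ∈ A <;>
      simp [exchange, MeasurableEquiv.arrowProdEquivProdArrow, Equiv.arrowProdEquivProdArrow, hi,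
        Finset.piecewise]
  · by_cases hi : i ∈ A <;>
      simp [exchange, MeasurableEquiv.arrowProdEquivProdArrow, Equiv.arrowProdEquivProdArrow, hi,
        Finset.piecewise]

variable (μ : ι → Measure α) [∀ i, IsProbabilityMeasure (μ i)] {f : (ι → α) → ℝ}

lemma memLp_exchange (hf : MemLp f 2 (Measure.pi μ)) (A : Finset ι) :
    MemLp (fun z => f (exchange A z).1) 2 ((Measure.pi μ).prod (Measure.pi μ)) :=
  (hf.comp_measurePreserving measurePreserving_fst).comp_measurePreserving
    (measurePreserving_exchange μ A)

lemma integral_exchange (A : Finset ι) {g : (ι → α) × (ι → α) → ℝ}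
    (hg : Measurable g) :
    ∫ z, g (exchange A z) ∂((Measure.pi μ).prod (Measure.pi μ)) =
      ∫ z, g z ∂((Measure.pi μ).prod (Measure.pi μ)) := by
  have h := measurePreserving_exchange μ A
  conv_rhs => rw [← h.map_eq]
  rw [integral_map h.measurable.aemeasurable hg.aestronglyMeasurable]

lemma _root_.MeasureTheory.MemLp.integrable_mul_sub {Ω : Type*} [MeasurableSpace Ω]
    {ν : Measure Ω} {u v w : Ω → ℝ} (hu : MemLp u 2 ν) (hv : MemLp v 2 ν) (hw : MemLp w 2 ν) :
    Integrable (fun z => u z * (v z - w z)) ν :=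
  hu.integrable_mul (hv.sub hw)

lemma _root_.MeasureTheory.MemLp.integrable_sub_sq {Ω : Type*} [MeasurableSpace Ω]
    {ν : Measure Ω} {u v : Ω → ℝ} (hu : MemLp u 2 ν) (hv : MemLp v 2 ν) :
    Integrable (fun z => (u z - v z) ^ 2) ν :=
  (hu.sub hv).integrable_sq

/-- Telescope over the coordinates of `A`. Writing f^B for f after exchanging B, exchanging k shows
that the increment E f(f^A − f^{A∪k}) equals E f^k(f^{A∪k} − f^A). It is therefore half of E (f^k −
f)(f^{A∪k} − f^A), where both factors have the same second moment. -/
lemma integral_mul_sub_exchange_le (hfm : Measurable f) (hf : MemLp f 2 (Measure.pi μ))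
    (A : Finset ι) :
    ∫ z, f z.1 * (f z.1 - f (exchange A z).1) ∂((Measure.pi μ).prod (Measure.pi μ)) ≤
      ∑ k ∈ A, (1 / 2) * ∫ z, (f (exchange {k} z).1 - f z.1) ^ 2
        ∂((Measure.pi μ).prod (Measure.pi μ)) := by
  set ν := (Measure.pi μ).prod (Measure.pi μ)
  have hex (B : Finset ι) : Measurable (exchange B : (ι → α) × (ι → α) → _) :=
    (measurePreserving_exchange μ B).measurable
  have hm (B : Finset ι) : Measurable fun z : (ι → α) × (ι → α) => f (exchange B z).1 :=
    hfm.comp (measurable_fst.comp (hex B))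
  have hL (B : Finset ι) : MemLp (fun z => f (exchange B z).1) 2 ν := memLp_exchange μ hf B
  have hL0 : MemLp (fun z : (ι → α) × (ι → α) => f z.1) 2 ν := by
    simpa [exchange_empty] using hL ∅
  have hm0 : Measurable fun z : (ι → α) × (ι → α) => f z.1 := by
    simpa [exchange_empty] using hm ∅
  induction A using Finset.induction_on with
  | empty => simp [exchange_empty]
  | insert k A hk ih =>
    rw [Finset.sum_insert hk]
    have hsplit : ∫ z, f z.1 * (f z.1 - f (exchange (insert k A) z).1) ∂ν =
        ∫ z, f z.1 * (f (exchange A z).1 - f (exchange (insert k A) z).1) ∂ν +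
        ∫ z, f z.1 * (f z.1 - f (exchange A z).1) ∂ν := by
      rw [← integral_add (hL0.integrable_mul_sub (hL _) (hL _))
        (hL0.integrable_mul_sub hL0 (hL _))]
      refine integral_congr_ae (Eventually.of_forall fun z => ?_)
      simp only []
      ring
    have hswap : ∫ z, f z.1 * (f (exchange A z).1 - f (exchange (insert k A) z).1) ∂ν =
        ∫ z, f (exchange {k} z).1 * (f (exchange (insert k A) z).1 - f (exchange A z).1) ∂ν := by
      rw [← integral_exchange μ {k} (g := fun z => f z.1 * (f (exchange A z).1 -
        f (exchange (insert k A) z).1)) (hm0.mul ((hm A).sub (hm (insert k A))))]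
      refine integral_congr_ae (Eventually.of_forall fun z => ?_)
      simp only []
      rw [exchange_exchange_singleton hk, ← exchange_exchange_singleton hk (exchange {k} z),
        exchange_exchange]
    have hA : ∫ z, (f (exchange (insert k A) z).1 - f (exchange A z).1) ^ 2 ∂ν =
        ∫ z, (f (exchange {k} z).1 - f z.1) ^ 2 ∂ν := by
      rw [← integral_exchange μ A (g := fun z => (f (exchange {k} z).1 - f z.1) ^ 2)
        (((hm {k}).sub hm0).pow_const 2)]
      refine integral_congr_ae (Eventually.of_forall fun z => ?_)
      simp only []
      rw [exchange_singleton_exchange hk]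
    have hI1 := (hL {k}).integrable_sub_sq hL0
    have hI2 := (hL (insert k A)).integrable_sub_sq (hL A)
    have hAM : ∫ z, f z.1 * (f (exchange A z).1 - f (exchange (insert k A) z).1) ∂ν +
        ∫ z, f (exchange {k} z).1 * (f (exchange (insert k A) z).1 - f (exchange A z).1) ∂ν ≤
        ∫ z, ((1 / 2) * (f (exchange {k} z).1 - f z.1) ^ 2 +
          (1 / 2) * (f (exchange (insert k A) z).1 - f (exchange A z).1) ^ 2) ∂ν := by
      rw [← integral_add (hL0.integrable_mul_sub (hL _) (hL _))
        ((hL _).integrable_mul_sub (hL _) (hL _))]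
      refine integral_mono ((hL0.integrable_mul_sub (hL _) (hL _)).add
        ((hL _).integrable_mul_sub (hL _) (hL _)))
        ((hI1.const_mul _).add (hI2.const_mul _)) fun z => ?_
      simp only []
      nlinarith [sq_nonneg ((f (exchange {k} z).1 - f z.1) -
        (f (exchange (insert k A) z).1 - f (exchange A z).1))]
    rw [integral_add (hI1.const_mul _) (hI2.const_mul _), integral_const_mul,
      integral_const_mul] at hAM
    linarith

/-- The **Efron–Stein inequality**, in the form that involves only the increases of `f` under
resampling of one coordinate. -/
theorem variance_le_sum_integral_sq_posPart (hfm : Measurable f) (hf : MemLp f 2 (Measure.pi μ)) :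
    Var[f; Measure.pi μ] ≤ ∑ k, ∫ z, (max (f (Function.update z.1 k (z.2 k)) - f z.1) 0) ^ 2
      ∂((Measure.pi μ).prod (Measure.pi μ)) := by
  set ν := (Measure.pi μ).prod (Measure.pi μ) with hν
  have hex (B : Finset ι) : Measurable (exchange B : (ι → α) × (ι → α) → _) :=
    (measurePreserving_exchange μ B).measurable
  have hm (B : Finset ι) : Measurable fun z : (ι → α) × (ι → α) => f (exchange B z).1 :=
    hfm.comp (measurable_fst.comp (hex B))
  have hL (B : Finset ι) : MemLp (fun z => f (exchange B z).1) 2 ν := memLp_exchange μ hf B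
  have hL0 : MemLp (fun z : (ι → α) × (ι → α) => f z.1) 2 ν := by
    simpa [exchange_empty] using hL ∅
  have hm0 : Measurable fun z : (ι → α) × (ι → α) => f z.1 := by
    simpa [exchange_empty] using hm ∅
  -- Exchanging all coordinates replaces the configuration by its independent copy, so the cross
  -- term is (E f)².
  have hvar : Var[f; Measure.pi μ] =
      ∫ z, f z.1 * (f z.1 - f (exchange Finset.univ z).1) ∂ν := by
    have hu (z : (ι → α) × (ι → α)) : (exchange Finset.univ z).1 = z.2 := by simp [exchange]
    have h1 : ∫ z, f z.1 * (f z.1 - f (exchange Finset.univ z).1) ∂ν =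
        ∫ z, (f z.1 ^ 2 * 1 - f z.1 * f z.2) ∂ν := by
      refine integral_congr_ae (Eventually.of_forall fun z => ?_)
      simp only [hu]
      ring
    have hLu := hL Finset.univ
    simp only [hu] at hLu
    have hI : Integrable (fun z : (ι → α) × (ι → α) => f z.1 * f z.2) ν :=
      hL0.integrable_mul hLu
    rw [variance_eq_sub hf, h1, integral_sub (by simpa using hL0.integrable_sq) hI, hν,
      integral_prod_mul (fun x => f x ^ 2) (fun _ => (1 : ℝ)), integral_prod_mul f f]
    simp [sq]
  rw [hvar]
  refine (integral_mul_sub_exchange_le μ hfm hf Finset.univ).trans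
    (Finset.sum_le_sum fun k _ => ?_)
  have hup (z : (ι → α) × (ι → α)) :
      (exchange {k} z).1 = Function.update z.1 k (z.2 k) := by
    simp [exchange, Finset.piecewise_singleton]
  simp only [← hup]
  have hp : MemLp (fun z => max (f (exchange {k} z).1 - f z.1) 0) 2 ν :=
    ((hL {k}).sub hL0).pos_part
  have hp' : MemLp (fun z => max (f z.1 - f (exchange {k} z).1) 0) 2 ν :=
    (hL0.sub (hL {k})).pos_part
  -- Increases and decreases have equal second moments, so keeping only increases cancels the factor
  -- 1/2.
  have hsymm : ∫ z, (max (f z.1 - f (exchange {k} z).1) 0) ^ 2 ∂ν =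
      ∫ z, (max (f (exchange {k} z).1 - f z.1) 0) ^ 2 ∂ν := by
    rw [← integral_exchange μ {k} (g := fun z => (max (f z.1 - f (exchange {k} z).1) 0) ^ 2)
      (((hm0.sub (hm {k})).max measurable_const).pow_const 2)]
    refine integral_congr_ae (Eventually.of_forall fun z => ?_)
    simp only []
    rw [exchange_exchange]
  have hsum : ∫ z, (f (exchange {k} z).1 - f z.1) ^ 2 ∂ν =
      ∫ z, (max (f (exchange {k} z).1 - f z.1) 0) ^ 2 ∂ν +
        ∫ z, (max (f z.1 - f (exchange {k} z).1) 0) ^ 2 ∂ν := by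
    rw [← integral_add hp.integrable_sq hp'.integrable_sq]
    refine integral_congr_ae (Eventually.of_forall fun z => ?_)
    simp only []
    rcases le_total (f (exchange {k} z).1) (f z.1) with h | h
    · rw [max_eq_right (by linarith), max_eq_left (by linarith)]; ring
    · rw [max_eq_left (by linarith), max_eq_right (by linarith)]; ring
  rw [hsum, hsymm]
  linarith

end EfronStein

/-! ### Variance of a minimum of sums of independent variables -/

section MinimumOfSums

variable {ι κ : Type*}

/-- The coordinates common to all minimising sets. -/
def IsPivotal (B : κ → Finset ι) (x : ι → ℝ) (i : ι) : Prop :=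
  ∀ k, ∑ j ∈ B k, |x j| = ⨅ l, ∑ j ∈ B l, |x j| → i ∈ B k

lemma bddBelow_range_sum_abs (B : κ → Finset ι) (x : ι → ℝ) :
    BddBelow (Set.range fun k => ∑ j ∈ B k, |x j|) :=
  ⟨0, by rintro _ ⟨k, rfl⟩; exact Finset.sum_nonneg fun _ _ => abs_nonneg _⟩

lemma measurable_sum_abs (B : Finset ι) : Measurable fun x : ι → ℝ => ∑ j ∈ B, |x j| :=
  Finset.measurable_sum _ fun j _ => (measurable_pi_apply j).abs

lemma measurable_iInf_sum_abs [Countable κ] (B : κ → Finset ι) :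
    Measurable fun x : ι → ℝ => ⨅ k, ∑ j ∈ B k, |x j| :=
  Measurable.iInf fun k => measurable_sum_abs (B k)

lemma measurableSet_isPivotal [Countable κ] (B : κ → Finset ι) (i : ι) :
    MeasurableSet {x : ι → ℝ | IsPivotal B x i} := by
  simp only [IsPivotal, Set.ofPred_forall]
  refine MeasurableSet.iInter fun k => ?_
  by_cases hi : i ∈ B k
  · simp [hi]
  · simp only [hi, imp_false]
    exact (measurableSet_eq_fun (measurable_sum_abs _) (measurable_iInf_sum_abs _)).compl

/-- Resampling one coordinate increases the minimum only if the coordinate is pivotal, and then by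
at most the new value. -/
lemma posPart_iInf_update_sub_le [Finite κ] [Nonempty κ] [DecidableEq ι] (B : κ → Finset ι)
    (x : ι → ℝ) (i : ι) (y : ℝ) :
    (max ((⨅ k, ∑ j ∈ B k, |Function.update x i y j|) - ⨅ k, ∑ j ∈ B k, |x j|) 0) ^ 2 ≤
      {x | IsPivotal B x i}.indicator 1 x * y ^ 2 := by
  by_cases hp : IsPivotal B x i
  · obtain ⟨k, hk⟩ := exists_eq_ciInf_of_finite (f := fun k => ∑ j ∈ B k, |x j|)
    have hle : (⨅ k, ∑ j ∈ B k, |Function.update x i y j|) - ⨅ k, ∑ j ∈ B k, |x j| ≤ |y| := by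
      have h1 : ⨅ k, ∑ j ∈ B k, |Function.update x i y j| ≤
          ∑ j ∈ B k, |Function.update x i y j| :=
        ciInf_le (bddBelow_range_sum_abs B _) k
      have hi := hp k hk
      rw [← Finset.add_sum_erase _ _ hi] at h1
      have h2 : ∑ j ∈ (B k).erase i, |Function.update x i y j| = ∑ j ∈ (B k).erase i, |x j| :=
        Finset.sum_congr rfl fun j hj => by
          rw [Function.update_of_ne (Finset.ne_of_mem_erase hj)]
      have h3 := Finset.add_sum_erase (B k) (fun j => |x j|) hi
      simp only [Function.update_self] at h1
      have := abs_nonneg (x i)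
      linarith
    have hmax := max_le hle (abs_nonneg y)
    rw [Set.indicator_of_mem (by exact hp), Pi.one_apply, one_mul, ← sq_abs y]
    -- In the other case some minimiser avoids `i`; its sum is unchanged, so the minimum cannot
    -- increase.
    exact pow_le_pow_left₀ (le_max_right _ _) hmax 2
  · rw [Set.indicator_of_notMem (by exact hp), zero_mul]
    simp only [IsPivotal, not_forall] at hp
    obtain ⟨k, hk, hi⟩ := hp
    have h1 : ⨅ k, ∑ j ∈ B k, |Function.update x i y j| ≤
        ∑ j ∈ B k, |Function.update x i y j| :=
      ciInf_le (bddBelow_range_sum_abs B _) k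
    have h2 : ∑ j ∈ B k, |Function.update x i y j| = ∑ j ∈ B k, |x j| :=
      Finset.sum_congr rfl fun j hj => by
        rw [Function.update_of_ne (by rintro rfl; exact hi hj)]
    rw [max_eq_right (by linarith)]
    simp

/-- Pivotality depends on the old configuration and the increase is bounded by the independent new
value, so each Efron–Stein term factors into a probability times a second moment. -/
lemma variance_pi_iInf_sum_abs_le [Fintype ι] [Finite κ] [Nonempty κ]
    (μ : ι → Measure ℝ) [∀ i, IsProbabilityMeasure (μ i)] {K : ℝ}
    (hμ : ∀ i, MemLp id 2 (μ i)) (hK : ∀ i, ∫ x, x ^ 2 ∂(μ i) ≤ K) (B : κ → Finset ι) :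
    Var[fun x : ι → ℝ => ⨅ k, ∑ j ∈ B k, |x j|; Measure.pi μ] ≤
      K * ∑ i, (Measure.pi μ).real {x | IsPivotal B x i} := by
  classical
  have hcoord (i : ι) : MemLp (fun x : ι → ℝ => x i) 2 (Measure.pi μ) :=
    (hμ i).comp_measurePreserving (measurePreserving_eval μ i)
  have hsq (i : ι) : ∫ x : ι → ℝ, x i ^ 2 ∂(Measure.pi μ) = ∫ y, y ^ 2 ∂(μ i) := by
    rw [← (measurePreserving_eval μ i).map_eq, integral_map
      (measurePreserving_eval μ i).measurable.aemeasurable (by fun_prop)]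
  have hmem : MemLp (fun x : ι → ℝ => ⨅ k, ∑ j ∈ B k, |x j|) 2 (Measure.pi μ) := by
    obtain ⟨k⟩ := ‹Nonempty κ›
    refine (memLp_finsetSum (B k) fun j _ => (hcoord j).norm).of_le
      (measurable_iInf_sum_abs B).aestronglyMeasurable (Eventually.of_forall fun x => ?_)
    rw [Real.norm_of_nonneg (Real.iInf_nonneg fun k => Finset.sum_nonneg fun _ _ => abs_nonneg _),
      Real.norm_of_nonneg (Finset.sum_nonneg fun _ _ => norm_nonneg _)]
    exact ciInf_le (bddBelow_range_sum_abs B x) k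
  refine (variance_le_sum_integral_sq_posPart μ (measurable_iInf_sum_abs B) hmem).trans ?_
  rw [Finset.mul_sum]
  refine Finset.sum_le_sum fun i _ => ?_
  have hI : Integrable (fun z : (ι → ℝ) × (ι → ℝ) =>
      {x | IsPivotal B x i}.indicator (1 : (ι → ℝ) → ℝ) z.1 * (z.2 i) ^ 2)
      ((Measure.pi μ).prod (Measure.pi μ)) :=
    Integrable.mul_prod ((integrable_const (1 : ℝ)).indicator (measurableSet_isPivotal B i))
      (hcoord i).integrable_sq
  calc _ ≤ ∫ z : (ι → ℝ) × (ι → ℝ), {x | IsPivotal B x i}.indicator (1 : (ι → ℝ) → ℝ) z.1 *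
        (z.2 i) ^ 2 ∂((Measure.pi μ).prod (Measure.pi μ)) :=
        integral_mono_of_nonneg (Eventually.of_forall fun z => sq_nonneg _) hI
          (Eventually.of_forall fun z => posPart_iInf_update_sub_le B z.1 i (z.2 i))
    _ = (Measure.pi μ).real {x | IsPivotal B x i} * ∫ y, y ^ 2 ∂(μ i) := by
        rw [integral_prod_mul ({x | IsPivotal B x i}.indicator (1 : (ι → ℝ) → ℝ))
          (fun y : ι → ℝ => y i ^ 2), integral_indicator_one (measurableSet_isPivotal B i), hsq]
    _ ≤ K * (Measure.pi μ).real {x | IsPivotal B x i} := by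
        rw [mul_comm]
        exact mul_le_mul_of_nonneg_right (hK i) measureReal_nonneg

variable {Ω : Type*} [MeasurableSpace Ω] {P : Measure Ω} {t : ι → Ω → ℝ}

lemma memLp_iInf_sum [Countable κ] (ht : ∀ i, Measurable (t i)) (h0 : ∀ i ω, 0 ≤ t i ω)
    (h2 : ∀ i, MemLp (t i) 2 P) (A : κ → Finset ι) (k₀ : κ) :
    MemLp (fun ω => ⨅ k, ∑ i ∈ A k, t i ω) 2 P := by
  refine (memLp_finsetSum (A k₀) fun j _ => h2 j).of_le
    (Measurable.iInf fun k => Finset.measurable_sum _ fun i _ => ht i).aestronglyMeasurable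
    (Eventually.of_forall fun ω => ?_)
  rw [Real.norm_of_nonneg (Real.iInf_nonneg fun k => Finset.sum_nonneg fun i _ => h0 i ω),
    Real.norm_of_nonneg (Finset.sum_nonneg fun i _ => h0 i ω)]
  exact ciInf_le ⟨0, by rintro _ ⟨k, rfl⟩; exact Finset.sum_nonneg fun i _ => h0 i ω⟩ k₀

variable [IsProbabilityMeasure P] {K : ℝ} {N : Ω → ℝ}

/-- The variance of a minimum of finitely many sums of independent nonnegative variables is at most
linear in the expected number of terms of a minimising sum. -/
lemma variance_iInf_sum_le_of_finite [Finite κ] [Nonempty κ] (ht : ∀ i, Measurable (t i))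
    (hindep : iIndepFun t P) (h0 : ∀ i ω, 0 ≤ t i ω) (h2 : ∀ i, MemLp (t i) 2 P)
    (hK : ∀ i, ∫ ω, t i ω ^ 2 ∂P ≤ K) (hK0 : 0 ≤ K) (A : κ → Finset ι) (hN : Integrable N P)
    (hA : ∀ᵐ ω ∂P, ∀ k, ∑ i ∈ A k, t i ω = ⨅ l, ∑ i ∈ A l, t i ω → ((A k).card : ℝ) ≤ N ω) :
    Var[fun ω => ⨅ k, ∑ i ∈ A k, t i ω; P] ≤ K * ∫ ω, N ω ∂P := by
  classical
  have := Fintype.ofFinite κ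
  -- Only the finitely many coordinates in `F` matter, which brings the problem to a finite product
  -- measure.
  set F : Finset ι := Finset.univ.biUnion A
  have hF (k : κ) : ∀ i ∈ A k, i ∈ F := fun i hi =>
    Finset.mem_biUnion.2 ⟨k, Finset.mem_univ k, hi⟩
  set B : κ → Finset F := fun k => (A k).subtype (· ∈ F)
  set X : Ω → F → ℝ := fun ω i => t i ω
  have hX : Measurable X := measurable_pi_lambda _ fun i => ht i
  have hsum (ω : Ω) (k : κ) : ∑ j ∈ B k, |X ω j| = ∑ i ∈ A k, t i ω := by
    rw [Finset.sum_subtype_of_mem (fun i => |t i ω|) (hF k)]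
    exact Finset.sum_congr rfl fun i _ => abs_of_nonneg (h0 i ω)
  have hcard (k : κ) : (B k).card = (A k).card := by
    rw [Finset.card_subtype, Finset.filter_true_of_mem (hF k)]
  have hmap : P.map X = Measure.pi fun i : F => P.map (t i) :=
    (iIndepFun_iff_map_fun_eq_pi_map fun i : F => (ht i).aemeasurable).1
      (hindep.precomp Subtype.val_injective)
  have (i : F) : IsProbabilityMeasure (P.map (t i)) :=
    Measure.isProbabilityMeasure_map (ht i).aemeasurable
  have hvar := variance_pi_iInf_sum_abs_le (fun i : F => P.map (t i)) (K := K)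
    (fun i => (memLp_map_measure_iff aestronglyMeasurable_id (ht i).aemeasurable).2 (h2 i))
    (fun i => by
      rw [integral_map (ht i).aemeasurable (by fun_prop)]
      exact hK i) B
  rw [← hmap, variance_map (measurable_iInf_sum_abs B).aemeasurable hX.aemeasurable] at hvar
  have hcomp : ((fun x : F → ℝ => ⨅ k, ∑ j ∈ B k, |x j|) ∘ X) =
      fun ω => ⨅ k, ∑ i ∈ A k, t i ω := by
    funext ω
    simp only [Function.comp_apply, hsum]
  rw [hcomp] at hvar
  refine hvar.trans (mul_le_mul_of_nonneg_left ?_ hK0)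
  have hms (i : F) : MeasurableSet (X ⁻¹' {x | IsPivotal B x i}) :=
    hX (measurableSet_isPivotal B i)
  have hreal (i : F) : (P.map X).real {x | IsPivotal B x i} =
      ∫ ω, (X ⁻¹' {x | IsPivotal B x i}).indicator (1 : Ω → ℝ) ω ∂P := by
    rw [integral_indicator_one (hms i), map_measureReal_apply hX (measurableSet_isPivotal B i)]
  have hint (i : F) : Integrable ((X ⁻¹' {x | IsPivotal B x i}).indicator (1 : Ω → ℝ)) P :=
    (integrable_const (1 : ℝ)).indicator (hms i)
  simp only [hreal]
  rw [← integral_finsetSum _ fun i _ => hint i]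
  refine integral_mono_ae (integrable_finsetSum _ fun i _ => hint i) hN ?_
  filter_upwards [hA] with ω hω
  -- All pivotal coordinates lie in this one minimising set, so its cardinality bounds their number.
  obtain ⟨k, hk⟩ := exists_eq_ciInf_of_finite (f := fun k => ∑ i ∈ A k, t i ω)
  refine le_trans ?_ (hω k hk)
  have hsum_card : ((A k).card : ℝ) = ∑ i : F, if i ∈ B k then (1 : ℝ) else 0 := by
    rw [← hcard, Finset.sum_boole, Finset.filter_mem_eq_inter, Finset.univ_inter]
  rw [hsum_card]
  refine Finset.sum_le_sum fun i _ => ?_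
  by_cases hi : ω ∈ X ⁻¹' {x | IsPivotal B x i}
  · rw [Set.indicator_of_mem hi, if_pos (hi k (by simp only [hsum]; exact hk)), Pi.one_apply]
  · rw [Set.indicator_of_notMem hi]
    split_ifs <;> norm_num

lemma tendsto_iInf_fin {u : ℕ → ℝ} (hu : ∀ n, 0 ≤ u n) :
    Tendsto (fun n : ℕ => ⨅ j : Fin (n + 1), u j) atTop (𝓝 (⨅ j, u j)) := by
  have hb : BddBelow (Set.range u) := ⟨0, by rintro _ ⟨j, rfl⟩; exact hu j⟩
  have hbn (n : ℕ) : BddBelow (Set.range fun j : Fin (n + 1) => u j) :=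
    ⟨0, by rintro _ ⟨j, rfl⟩; exact hu j⟩
  refine tendsto_order.2 ⟨fun a ha => Eventually.of_forall fun n => ha.trans_le ?_, fun a ha => ?_⟩
  · exact le_ciInf fun j => ciInf_le hb _
  · obtain ⟨j, hj⟩ := exists_lt_of_ciInf_lt ha
    filter_upwards [eventually_ge_atTop j] with n hn
    exact (ciInf_le (hbn n) ⟨j, by omega⟩).trans_lt hj

/-- The infimum is the limit of minima over finite initial families, dominated by the sum over `A
k₀`, so variances converge. Stating `hA` by comparison with `k₀` makes one `N` serve every
truncation. -/
theorem variance_iInf_sum_le [Countable κ] (ht : ∀ i, Measurable (t i))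
    (hindep : iIndepFun t P) (h0 : ∀ i ω, 0 ≤ t i ω) (h2 : ∀ i, MemLp (t i) 2 P)
    (hK : ∀ i, ∫ ω, t i ω ^ 2 ∂P ≤ K) (hK0 : 0 ≤ K) (A : κ → Finset ι) (k₀ : κ)
    (hN : Integrable N P)
    (hA : ∀ᵐ ω ∂P, ∀ k, ∑ i ∈ A k, t i ω ≤ ∑ i ∈ A k₀, t i ω → ((A k).card : ℝ) ≤ N ω) :
    Var[fun ω => ⨅ k, ∑ i ∈ A k, t i ω; P] ≤ K * ∫ ω, N ω ∂P := by
  have : Nonempty κ := ⟨k₀⟩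
  obtain ⟨e, he⟩ := exists_surjective_nat κ
  -- `k₀` is enumerated first, so that every truncation contains it.
  set e' : ℕ → κ := fun n => Nat.casesOn n k₀ e with he'
  have hsurj : Function.Surjective e' := fun k => by
    obtain ⟨n, rfl⟩ := he k
    exact ⟨n + 1, rfl⟩
  have hnn (ω : Ω) (k : κ) : 0 ≤ ∑ i ∈ A k, t i ω := Finset.sum_nonneg fun i _ => h0 i ω
  have hbn (n : ℕ) (ω : Ω) :
      BddBelow (Set.range fun j : Fin (n + 1) => ∑ i ∈ A (e' j), t i ω) :=
    ⟨0, by rintro _ ⟨j, rfl⟩; exact hnn ω _⟩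
  set T : ℕ → Ω → ℝ := fun n ω => ⨅ j : Fin (n + 1), ∑ i ∈ A (e' j), t i ω with hT
  have hTle (n : ℕ) (ω : Ω) : T n ω ≤ ∑ i ∈ A k₀, t i ω :=
    ciInf_le (hbn n ω) ⟨0, by omega⟩
  have hT0 (n : ℕ) (ω : Ω) : 0 ≤ T n ω := Real.iInf_nonneg fun j => hnn ω _
  have hlim (ω : Ω) : Tendsto (fun n => T n ω) atTop (𝓝 (⨅ k, ∑ i ∈ A k, t i ω)) := by
    rw [← hsurj.iInf_comp]
    exact tendsto_iInf_fin fun n => hnn ω (e' n)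
  have hTL (n : ℕ) : MemLp (T n) 2 P := memLp_iInf_sum ht h0 h2 (fun j : Fin (n + 1) => A (e' j)) 0
  have hL := memLp_finsetSum (A k₀) fun j (_ : j ∈ A k₀) => h2 j
  have hvarlim : Tendsto (fun n => Var[T n; P]) atTop
      (𝓝 (Var[fun ω => ⨅ k, ∑ i ∈ A k, t i ω; P])) := by
    rw [variance_eq_sub (memLp_iInf_sum ht h0 h2 A k₀)]
    simp only [fun n => variance_eq_sub (hTL n)]
    refine Tendsto.sub ?_ (Tendsto.pow ?_ 2)
    · refine tendsto_integral_of_dominated_convergence (fun ω => (∑ i ∈ A k₀, t i ω) ^ 2)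
        (fun n => ((hTL n).1.pow 2)) hL.integrable_sq (fun n => Eventually.of_forall fun ω => ?_)
        (Eventually.of_forall fun ω => (hlim ω).pow 2)
      simp only [Pi.pow_apply, norm_pow, Real.norm_of_nonneg (hT0 n ω)]
      exact pow_le_pow_left₀ (hT0 n ω) (hTle n ω) 2
    · refine tendsto_integral_of_dominated_convergence (fun ω => ∑ i ∈ A k₀, t i ω)
        (fun n => (hTL n).1) (hL.integrable one_le_two)
        (fun n => Eventually.of_forall fun ω => ?_) (Eventually.of_forall hlim)
      rw [Real.norm_of_nonneg (hT0 n ω)]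
      exact hTle n ω
  refine le_of_tendsto' hvarlim fun n => ?_
  refine variance_iInf_sum_le_of_finite ht hindep h0 h2 hK hK0
    (fun j : Fin (n + 1) => A (e' j)) hN ?_
  filter_upwards [hA] with ω hω j hj
  exact hω _ (hj.le.trans (hTle n ω))

end MinimumOfSums

/-! ### Paths in the lattice: passage times, edge sets, counting -/

section Lattice

variable {d : ℕ}

lemma walkTime_append (τ : Edge d → ℝ) {x y z : Fin d → ℤ} (w : (lattice d).Walk x y)
    (w' : (lattice d).Walk y z) : walkTime τ (w.append w') = walkTime τ w + walkTime τ w' := by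
  simp [walkTime, SimpleGraph.Walk.darts_append]

lemma walkTime_reverse (τ : Edge d → ℝ) {x y : Fin d → ℤ} (w : (lattice d).Walk x y) :
    walkTime τ w.reverse = walkTime τ w := by
  simp [walkTime, SimpleGraph.Walk.darts_reverse, Function.comp_def]

lemma walkTime_nonneg {τ : Edge d → ℝ} (hτ : ∀ e, 0 ≤ τ e) {x y : Fin d → ℤ}
    (w : (lattice d).Walk x y) : 0 ≤ walkTime τ w := by
  refine List.sum_nonneg fun a ha => ?_
  obtain ⟨b, -, rfl⟩ := List.mem_map.1 ha
  exact hτ _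

/-- Loop erasure only drops edges; hence arbitrary walks, concatenations included, bound T_n from
above. -/
lemma walkTime_toPath_le {τ : Edge d → ℝ} (hτ : ∀ e, 0 ≤ τ e) {x y : Fin d → ℤ}
    (w : (lattice d).Walk x y) : walkTime τ w.toPath.1 ≤ walkTime τ w := by
  refine List.Sublist.sum_le_sum (w.darts_bypass_sublist_darts.map _) fun a ha => ?_
  obtain ⟨b, -, rfl⟩ := List.mem_map.1 ha
  exact hτ _

lemma bddBelow_range_walkTime {τ : Edge d → ℝ} (hτ : ∀ e, 0 ≤ τ e) (x y : Fin d → ℤ) :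
    BddBelow (Set.range fun π : (lattice d).Path x y => walkTime τ π.1) :=
  ⟨0, by rintro _ ⟨π, rfl⟩; exact walkTime_nonneg hτ _⟩

open Classical in
/-- The set of edges traversed by a walk. -/
noncomputable def walkEdges {x y : Fin d → ℤ} (w : (lattice d).Walk x y) : Finset (Edge d) :=
  (w.darts.map fun a => (⟨a.edge, a.edge_mem⟩ : Edge d)).toFinset

lemma nodup_edges_of_isPath {x y : Fin d → ℤ} {w : (lattice d).Walk x y} (hw : w.IsPath) :
    (w.darts.map fun a => (⟨a.edge, a.edge_mem⟩ : Edge d)).Nodup := by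
  refine List.Nodup.of_map (fun e : Edge d => e.1) ?_
  rw [List.map_map]
  exact hw.edges_nodup

lemma card_walkEdges {x y : Fin d → ℤ} {w : (lattice d).Walk x y} (hw : w.IsPath) :
    (walkEdges w).card = w.length := by
  classical
  rw [walkEdges, List.toFinset_card_of_nodup (nodup_edges_of_isPath hw)]
  simp

lemma walkTime_eq_sum (τ : Edge d → ℝ) {x y : Fin d → ℤ} {w : (lattice d).Walk x y}
    (hw : w.IsPath) : walkTime τ w = ∑ e ∈ walkEdges w, τ e := by
  classical
  rw [walkEdges, List.sum_toFinset _ (nodup_edges_of_isPath hw), List.map_map]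
  rfl

instance (x y : Fin d → ℤ) : Countable ((lattice d).Path x y) :=
  Function.Injective.countable (f := fun p : (lattice d).Path x y => p.1.support) fun _ _ h =>
    Subtype.ext (SimpleGraph.Walk.ext_support h)

instance : Countable (Edge d) :=
  have : Countable (Sym2 (Fin d → ℤ)) := inferInstanceAs (Countable (Quot _))
  inferInstanceAs (Countable {e // e ∈ (lattice d).edgeSet})

lemma abs_sub_le_one_of_adj {x y : Fin d → ℤ} (h : (lattice d).Adj x y) (i : Fin d) :
    |x i - y i| ≤ 1 := by
  have h' : ∑ i, |x i - y i| = 1 := h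
  rw [← h']
  exact Finset.single_le_sum (f := fun i => |x i - y i|) (fun _ _ => abs_nonneg _)
    (Finset.mem_univ i)

lemma abs_sub_le_length {x y : Fin d → ℤ} (w : (lattice d).Walk x y) (i : Fin d) :
    |x i - y i| ≤ w.length := by
  induction w with
  | nil => simp
  | @cons x z y h w ih =>
    have h1 := abs_sub_le_one_of_adj h i
    have h2 := abs_sub_le (x i) (z i) (y i)
    rw [SimpleGraph.Walk.length_cons]
    push_cast
    linarith

/-- The number of edge sets of walks of given length from a given vertex grows at most
exponentially. -/
lemma exists_finset_walkEdges (k : ℕ) (x : Fin d → ℤ) :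
    ∃ S : Finset (Finset (Edge d)), S.card ≤ (3 ^ d) ^ k ∧
      ∀ (y : Fin d → ℤ) (w : (lattice d).Walk x y), w.length = k → walkEdges w ∈ S := by
  classical
  induction k generalizing x with
  | zero =>
    refine ⟨{∅}, by simp, fun y w hw => ?_⟩
    cases w with
    | nil => simp [walkEdges]
    | cons h p => simp at hw
  | succ k ih =>
    choose S hS hmem using ih
    -- This box contains every neighbour of `x`; the crude count 3^d suffices, since only
    -- exponential growth matters.
    set V : Finset (Fin d → ℤ) := Fintype.piFinset fun i => Finset.Icc (x i - 1) (x i + 1)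
    have hV : V.card = 3 ^ d := by
      simp only [V, Fintype.card_piFinset, Int.card_Icc]
      have (i : Fin d) : (x i + 1 + 1 - (x i - 1)).toNat = 3 := by
        ring_nf
        rfl
      simp [this]
    refine ⟨V.biUnion fun z => (S z).image fun A =>
      if h : (lattice d).Adj x z then insert (⟨s(x, z), h⟩ : Edge d) A else A, ?_, ?_⟩
    · refine Finset.card_biUnion_le.trans ?_
      calc _ ≤ ∑ z ∈ V, (3 ^ d) ^ k :=
            Finset.sum_le_sum fun z _ => Finset.card_image_le.trans (hS z)
        _ = (3 ^ d) ^ (k + 1) := by rw [Finset.sum_const, hV, smul_eq_mul, pow_succ, mul_comm]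
    · intro y w hw
      cases w with
      | nil => simp at hw
      | @cons _ z _ h p =>
        refine Finset.mem_biUnion.2 ⟨z, ?_, Finset.mem_image.2 ⟨walkEdges p, hmem z y p ?_, ?_⟩⟩
        · refine Fintype.mem_piFinset.2 fun i => Finset.mem_Icc.2 ?_
          have := abs_le.1 (abs_sub_le_one_of_adj h i)
          constructor <;> linarith [this.1, this.2]
        · simpa using hw
        · rw [dif_pos h]
          simp [walkEdges, SimpleGraph.Dart.edge]

variable [NeZero d]

lemma axisPoint_zero : axisPoint d 0 = 0 := by simp [axisPoint]

lemma adj_axisPoint (n : ℕ) : (lattice d).Adj (axisPoint d n) (axisPoint d (n + 1)) := by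
  change ∑ i, |axisPoint d n i - axisPoint d (n + 1) i| = 1
  rw [Finset.sum_eq_single 0]
  · simp [axisPoint]
  · intro i _ hi
    simp [axisPoint, hi]
  · simp

/-- The edge joining `(n, 0, …, 0)` to `(n + 1, 0, …, 0)`. -/
def axisEdge (d : ℕ) [NeZero d] (n : ℕ) : Edge d :=
  ⟨s(axisPoint d n, axisPoint d (n + 1)), adj_axisPoint n⟩

lemma exists_axisWalk (m k : ℕ) :
    ∃ w : (lattice d).Walk (axisPoint d m) (axisPoint d (m + k)),
      ∀ τ : Edge d → ℝ, walkTime τ w = ∑ i ∈ Finset.range k, τ (axisEdge d (m + i)) := by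
  induction k with
  | zero => exact ⟨.nil, by simp [walkTime]⟩
  | succ k ih =>
    obtain ⟨w, hw⟩ := ih
    refine ⟨w.append (.cons (adj_axisPoint (m + k)) .nil), fun τ => ?_⟩
    rw [walkTime_append, hw, Finset.sum_range_succ]
    simp [walkTime, axisEdge, SimpleGraph.Dart.edge]

lemma exists_walk_zero_axisPoint (n : ℕ) :
    ∃ w : (lattice d).Walk 0 (axisPoint d n),
      ∀ τ : Edge d → ℝ, walkTime τ w = ∑ i ∈ Finset.range n, τ (axisEdge d i) := by
  have h := exists_axisWalk (d := d) 0 n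
  rw [axisPoint_zero, zero_add] at h
  simpa only [zero_add] using h

lemma le_length_of_walk_axisPoint {n : ℕ} (w : (lattice d).Walk 0 (axisPoint d n)) :
    n ≤ w.length := by
  have := abs_sub_le_length w 0
  simpa [axisPoint] using this

variable {Ω : Type*} {t : Edge d → Ω → ℝ}

lemma minTime_eq_iInf_sum (n : ℕ) (ω : Ω) :
    minTime t n ω = ⨅ π : (lattice d).Path 0 (axisPoint d n), ∑ e ∈ walkEdges π.1, t e ω :=
  iInf_congr fun π => walkTime_eq_sum _ π.2

lemma minTime_le_walkTime {ω : Ω} (h0 : ∀ e, 0 ≤ t e ω) {n : ℕ}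
    (w : (lattice d).Walk 0 (axisPoint d n)) : minTime t n ω ≤ walkTime (fun e => t e ω) w :=
  (ciInf_le (bddBelow_range_walkTime h0 _ _) w.toPath).trans (walkTime_toPath_le h0 w)

lemma nonempty_path (n : ℕ) : Nonempty ((lattice d).Path 0 (axisPoint d n)) :=
  ⟨(exists_walk_zero_axisPoint n).choose.toPath⟩

lemma minTime_le_sum_axisEdge {ω : Ω} (h0 : ∀ e, 0 ≤ t e ω) (n : ℕ) :
    minTime t n ω ≤ ∑ i ∈ Finset.range n, t (axisEdge d i) ω := by
  obtain ⟨w, hw⟩ := exists_walk_zero_axisPoint (d := d) n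
  exact (minTime_le_walkTime h0 w).trans_eq (hw _)

/-- Passage times to nearby points of the axis differ by at most the passage time of the segment
between them. -/
lemma abs_minTime_sub_le {ω : Ω} (h0 : ∀ e, 0 ≤ t e ω) (m k : ℕ) :
    |minTime t (m + k) ω - minTime t m ω| ≤
      ∑ i ∈ Finset.range k, t (axisEdge d (m + i)) ω := by
  obtain ⟨w, hw⟩ := exists_axisWalk (d := d) m k
  have := nonempty_path (d := d) m
  have := nonempty_path (d := d) (m + k)
  rw [← hw fun e => t e ω, abs_sub_le_iff]
  constructor
  · rw [sub_le_iff_le_add, ← sub_le_iff_le_add']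
    refine le_ciInf fun π => ?_
    have := minTime_le_walkTime h0 (π.1.append w)
    rw [walkTime_append] at this
    linarith
  · rw [sub_le_iff_le_add, ← sub_le_iff_le_add']
    refine le_ciInf fun π => ?_
    have := minTime_le_walkTime h0 (π.1.append w.reverse)
    rw [walkTime_append, walkTime_reverse] at this
    linarith

lemma measurable_minTime [MeasurableSpace Ω] (ht : ∀ e, Measurable (t e)) (n : ℕ) :
    Measurable (minTime t n) := by
  have : minTime t n = fun ω => ⨅ π : (lattice d).Path 0 (axisPoint d n),
      ∑ e ∈ walkEdges π.1, t e ω := funext fun ω => minTime_eq_iInf_sum n ω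
  rw [this]
  exact Measurable.iInf fun π => Finset.measurable_sum _ fun e _ => ht e

end Lattice

/-! ### Long self-avoiding paths are slow -/

section LargeDeviations

variable {Ω : Type*} [MeasurableSpace Ω] {P : Measure Ω} [IsProbabilityMeasure P]

lemma mgf_neg_le_measureReal_add_exp {X : Ω → ℝ} (hX : Measurable X) (h0 : ∀ ω, 0 ≤ X ω)
    {s : ℝ} (hs : 0 ≤ s) (ε : ℝ) :
    mgf X P (-s) ≤ P.real {ω | X ω < ε} + Real.exp (-s * ε) := by
  have hms : MeasurableSet {ω | X ω < ε} := measurableSet_lt hX measurable_const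
  have hI : Integrable ({ω | X ω < ε}.indicator (1 : Ω → ℝ)) P :=
    (integrable_const (1 : ℝ)).indicator hms
  calc mgf X P (-s)
      ≤ ∫ ω, ({ω | X ω < ε}.indicator (1 : Ω → ℝ) ω + Real.exp (-s * ε)) ∂P := by
        refine integral_mono_of_nonneg (Eventually.of_forall fun ω => (Real.exp_pos _).le)
          (hI.add (integrable_const _)) (Eventually.of_forall fun ω => ?_)
        simp only []
        by_cases h : X ω < ε
        · rw [Set.indicator_of_mem (by exact h), Pi.one_apply]
          have : Real.exp (-s * X ω) ≤ 1 := Real.exp_le_one_iff.2 (by nlinarith [h0 ω])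
          linarith [Real.exp_pos (-s * ε)]
        · rw [Set.indicator_of_notMem (by exact h), zero_add]
          exact Real.exp_le_exp.2 (by nlinarith [not_lt.1 h])
    _ = P.real {ω | X ω < ε} + Real.exp (-s * ε) := by
        rw [integral_add hI (integrable_const _), integral_indicator_one hms]
        simp

/-- Chernoff bound: at the level |A|/s the exponential prefactor is e^|A| ≤ 3^|A|, and independence
gives δ^|A|. -/
lemma measureReal_sum_le_le_pow {ι : Type*} {t : ι → Ω → ℝ} (ht : ∀ i, Measurable (t i))
    (hindep : iIndepFun t P) (h0 : ∀ i ω, 0 ≤ t i ω) {s δ : ℝ} (hs : 0 < s)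
    (hδ : ∀ i, mgf (t i) P (-s) ≤ δ) (A : Finset ι) :
    P.real {ω | ∑ i ∈ A, t i ω ≤ s⁻¹ * A.card} ≤ (3 * δ) ^ A.card := by
  have hm : Measurable fun ω => ∑ i ∈ A, t i ω := Finset.measurable_sum _ fun i _ => ht i
  have hint : Integrable (fun ω => Real.exp (-s * ∑ i ∈ A, t i ω)) P := by
    refine Integrable.of_bound (C := 1) (by fun_prop) (Eventually.of_forall fun ω => ?_)
    rw [Real.norm_of_nonneg (Real.exp_pos _).le]
    exact Real.exp_le_one_iff.2 (by
      nlinarith [Finset.sum_nonneg fun i (_ : i ∈ A) => h0 i ω])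
  refine (measure_le_le_exp_mul_mgf (s⁻¹ * A.card) (by linarith : -s ≤ 0) hint).trans ?_
  have hsum : (fun ω => ∑ i ∈ A, t i ω) = ∑ i ∈ A, t i := by
    funext ω
    simp
  rw [hsum, hindep.mgf_sum ht, mul_pow]
  refine mul_le_mul ?_ ?_ (Finset.prod_nonneg fun i _ => mgf_nonneg) (by positivity)
  · have : - -s * (s⁻¹ * A.card) = A.card * 1 := by field_simp
    rw [this, Real.exp_nat_mul]
    exact pow_le_pow_left₀ (Real.exp_pos _).le Real.exp_one_lt_three.le _
  · exact (Finset.prod_le_prod (fun i _ => mgf_nonneg) fun i _ => hδ i).trans_eq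
      (Finset.prod_const δ)

variable {d : ℕ} {t : Edge d → Ω → ℝ}

/-- Some self-avoiding path of length `k` from the origin has passage time at most `a k`. -/
def fastPathEvent (t : Edge d → Ω → ℝ) (a : ℝ) (k : ℕ) : Set Ω :=
  ⋃ (y : Fin d → ℤ) (π : (lattice d).Path 0 y) (_ : π.1.length = k),
    {ω | walkTime (fun e => t e ω) π.1 ≤ a * k}

lemma measurableSet_fastPathEvent (ht : ∀ e, Measurable (t e)) (a : ℝ) (k : ℕ) :
    MeasurableSet (fastPathEvent t a k) := by
  refine MeasurableSet.iUnion fun y => MeasurableSet.iUnion fun π => MeasurableSet.iUnion fun _ => ?_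
  simp only [walkTime_eq_sum _ π.2]
  exact measurableSet_le (Finset.measurable_sum _ fun e _ => ht e) measurable_const

/-- Choose ε so that the mass below ε is uniformly under δ/2, then s so that e^{-sε} < δ/2. -/
lemma exists_mgf_neg_le (ht : ∀ e, Measurable (t e)) (h0 : ∀ e ω, 0 ≤ t e ω)
    (hi : NoMassNearZero P t) {δ : ℝ} (hδ : 0 < δ) :
    ∃ s : ℝ, 0 < s ∧ ∀ e, mgf (t e) P (-s) ≤ δ := by
  have h1 : ∀ᶠ ε : ℝ in 𝓝[>] 0, ⨆ e, P {ω | t e ω < ε} < ENNReal.ofReal (δ / 2) :=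
    hi.eventually_lt_const (by positivity)
  obtain ⟨ε, hε, hε0⟩ := (h1.and self_mem_nhdsWithin).exists
  have hε0 : 0 < ε := hε0
  have h2 : Tendsto (fun s : ℝ => Real.exp (-(s * ε))) atTop (𝓝 0) :=
    Real.tendsto_exp_neg_atTop_nhds_zero.comp (tendsto_id.atTop_mul_const hε0)
  obtain ⟨s, hs, hs0⟩ := ((h2.eventually_lt_const (half_pos hδ)).and
    (eventually_gt_atTop 0)).exists
  refine ⟨s, hs0, fun e => (mgf_neg_le_measureReal_add_exp (ht e) (h0 e) hs0.le ε).trans ?_⟩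
  have h3 : P.real {ω | t e ω < ε} ≤ δ / 2 :=
    ENNReal.toReal_le_of_le_ofReal (by positivity)
      ((le_iSup (fun e => P {ω | t e ω < ε}) e).trans hε.le)
  rw [neg_mul]
  linarith

lemma exists_measureReal_fastPathEvent_le (ht : ∀ e, Measurable (t e)) (hindep : iIndepFun t P)
    (h0 : ∀ e ω, 0 ≤ t e ω) (hi : NoMassNearZero P t) :
    ∃ a : ℝ, 0 < a ∧ ∀ k, P.real (fastPathEvent t a k) ≤ (1 / 2) ^ k := by
  classical
  -- With this δ, the Chernoff factor 3δ times the counting factor 3^d equals 1/2.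
  obtain ⟨s, hs, hmgf⟩ := exists_mgf_neg_le ht h0 hi (δ := 1 / (6 * 3 ^ d)) (by positivity)
  refine ⟨s⁻¹, by positivity, fun k => ?_⟩
  obtain ⟨S, hS, hmem⟩ := exists_finset_walkEdges (d := d) k 0
  -- A self-avoiding path of length k has k distinct edges, so smaller edge sets can be discarded.
  set S' := S.filter fun A => A.card = k
  have hsub : fastPathEvent t s⁻¹ k ⊆ ⋃ A ∈ S', {ω | ∑ e ∈ A, t e ω ≤ s⁻¹ * A.card} := by
    intro ω hω
    simp only [fastPathEvent, Set.mem_iUnion] at hω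
    obtain ⟨y, π, hk, hω⟩ := hω
    have hcard : (walkEdges π.1).card = k := (card_walkEdges π.2).trans hk
    refine Set.mem_biUnion (Finset.mem_filter.2 ⟨hmem y π.1 hk, hcard⟩) ?_
    have hω' : walkTime (fun e => t e ω) π.1 ≤ s⁻¹ * k := hω
    rw [walkTime_eq_sum _ π.2] at hω'
    change ∑ e ∈ walkEdges π.1, t e ω ≤ s⁻¹ * (walkEdges π.1).card
    rwa [hcard]
  calc P.real (fastPathEvent t s⁻¹ k)
      ≤ P.real (⋃ A ∈ S', {ω | ∑ e ∈ A, t e ω ≤ s⁻¹ * A.card}) :=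
        measureReal_mono hsub (measure_ne_top _ _)
    _ ≤ ∑ A ∈ S', P.real {ω | ∑ e ∈ A, t e ω ≤ s⁻¹ * A.card} :=
        measureReal_biUnion_finset_le _ _
    _ ≤ ∑ A ∈ S', (3 * (1 / (6 * 3 ^ d))) ^ k := by
        refine Finset.sum_le_sum fun A hA => ?_
        have := measureReal_sum_le_le_pow ht hindep h0 hs hmgf A
        rwa [(Finset.mem_filter.1 hA).2] at this ⊢
    _ = S'.card * (1 / 2 * (1 / 3 ^ d)) ^ k := by
        rw [Finset.sum_const, nsmul_eq_mul]
        congr 2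
        field_simp
        norm_num
    _ ≤ ((3 ^ d) ^ k : ℝ) * (1 / 2 * (1 / 3 ^ d)) ^ k := by
        refine mul_le_mul_of_nonneg_right ?_ (by positivity)
        exact_mod_cast (Finset.card_filter_le _ _).trans hS
    _ = (1 / 2) ^ k := by
        rw [← mul_pow]
        congr 1
        field_simp

/-- Passage times of self-avoiding paths from the origin grow linearly with the length, up to an
integrable error. -/
theorem exists_length_le_walkTime_div_add (ht : ∀ e, Measurable (t e)) (hindep : iIndepFun t P)
    (h0 : ∀ e ω, 0 ≤ t e ω) (hi : NoMassNearZero P t) :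
    ∃ (a : ℝ) (R : Ω → ℝ), 0 < a ∧ Integrable R P ∧ ∀ᵐ ω ∂P, ∀ (y : Fin d → ℤ)
      (π : (lattice d).Path 0 y), (π.1.length : ℝ) ≤ walkTime (fun e => t e ω) π.1 / a + R ω := by
  obtain ⟨a, ha, hP⟩ := exists_measureReal_fastPathEvent_le ht hindep h0 hi
  -- The sum of all lengths at which a fast path exists dominates each such length, and its mean is
  -- at most Σ k 2^{-k}.
  set G : Ω → ℝ≥0∞ := fun ω => ∑' k : ℕ, (fastPathEvent t a k).indicator (fun _ => (k : ℝ≥0∞)) ω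
  have hms := measurableSet_fastPathEvent ht a
  have hG : Measurable G := Measurable.tsum fun k => measurable_const.indicator (hms k)
  have hfin : ∫⁻ ω, G ω ∂P ≠ ∞ := by
    have hsum : Summable fun k : ℕ => (k : ℝ) ^ 1 * (1 / 2 : ℝ) ^ k :=
      summable_pow_mul_geometric_of_norm_lt_one 1 (by norm_num)
    refine ne_top_of_le_ne_top hsum.tsum_ofReal_ne_top ?_
    rw [lintegral_tsum fun k => (measurable_const.indicator (hms k)).aemeasurable]
    refine ENNReal.tsum_le_tsum fun k => ?_
    rw [lintegral_indicator_const (hms k), pow_one, ENNReal.ofReal_mul (by positivity),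
      ENNReal.ofReal_natCast]
    gcongr
    exact (ENNReal.le_ofReal_iff_toReal_le (measure_ne_top _ _) (by positivity)).2 (hP k)
  refine ⟨a, fun ω => (G ω).toReal, ha, integrable_toReal_of_lintegral_ne_top hG.aemeasurable hfin,
    ?_⟩
  filter_upwards [ae_lt_top hG hfin] with ω hω y π
  by_cases h : walkTime (fun e => t e ω) π.1 ≤ a * π.1.length
  · have hmem : ω ∈ fastPathEvent t a π.1.length := by
      simp only [fastPathEvent, Set.mem_iUnion]
      exact ⟨y, π, rfl, h⟩
    have h1 : (π.1.length : ℝ≥0∞) ≤ G ω := by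
      refine le_trans ?_ (ENNReal.le_tsum π.1.length)
      rw [Set.indicator_of_mem hmem]
    have h2 := ENNReal.toReal_mono hω.ne h1
    rw [ENNReal.toReal_natCast] at h2
    have h3 := div_nonneg (walkTime_nonneg (fun e => h0 e ω) π.1) ha.le
    linarith
  · have h1 : (π.1.length : ℝ) ≤ walkTime (fun e => t e ω) π.1 / a := by
      rw [le_div_iff₀ ha]
      linarith [not_le.1 h]
    linarith [ENNReal.toReal_nonneg (a := G ω)]

end LargeDeviations

/-! ### Variance, convergence and growth for nonnegative passage times -/

section NonnegativeTimes

variable {Ω : Type*} [MeasurableSpace Ω] {P : Measure Ω}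

/-- The sum of the squares has finite expectation, hence is almost surely finite, and its terms
vanish. -/
lemma ae_tendsto_zero_of_summable_integral_sq {X : ℕ → Ω → ℝ} {c : ℕ → ℝ}
    (hX : ∀ k, MemLp (X k) 2 P) (hc : ∀ k, ∫ ω, X k ω ^ 2 ∂P ≤ c k) (hsum : Summable c) :
    ∀ᵐ ω ∂P, Tendsto (fun k => X k ω) atTop (𝓝 0) := by
  have hm (k : ℕ) : AEMeasurable (fun ω => ENNReal.ofReal (X k ω ^ 2)) P :=
    ((hX k).1.aemeasurable.pow_const 2).ennreal_ofReal
  have hfin : ∫⁻ ω, ∑' k, ENNReal.ofReal (X k ω ^ 2) ∂P ≠ ∞ := by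
    rw [lintegral_tsum hm]
    refine ne_top_of_le_ne_top hsum.tsum_ofReal_ne_top (ENNReal.tsum_le_tsum fun k => ?_)
    rw [← ofReal_integral_eq_lintegral_ofReal (hX k).integrable_sq
      (Eventually.of_forall fun ω => sq_nonneg _)]
    exact ENNReal.ofReal_le_ofReal (hc k)
  filter_upwards [ae_lt_top' (AEMeasurable.tsum hm) hfin] with ω hω
  have h1 := ENNReal.tendsto_atTop_zero_of_tsum_ne_top hω.ne
  have h2 : Tendsto (fun k => X k ω ^ 2) atTop (𝓝 0) := by
    have := (ENNReal.tendsto_toReal ENNReal.zero_ne_top).comp h1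
    simpa [Function.comp_def, ENNReal.toReal_ofReal (sq_nonneg _)] using this
  have h3 := h2.sqrt
  simp only [Real.sqrt_sq_eq_abs, Real.sqrt_zero] at h3
  exact (tendsto_zero_iff_abs_tendsto_zero _).2 h3

lemma tendsto_eLpNorm_two_of_integral_sq {X : ℕ → Ω → ℝ} (hX : ∀ k, MemLp (X k) 2 P)
    (h : Tendsto (fun k => ∫ ω, X k ω ^ 2 ∂P) atTop (𝓝 0)) :
    Tendsto (fun k => eLpNorm (X k) 2 P) atTop (𝓝 0) := by
  simp only [fun k => (hX k).eLpNorm_eq_integral_rpow_norm two_ne_zero ENNReal.ofNat_ne_top]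
  have h1 : Tendsto (fun k => (∫ ω, X k ω ^ 2 ∂P) ^ (2 : ℝ)⁻¹) atTop (𝓝 (0 ^ (2 : ℝ)⁻¹)) :=
    h.rpow_const (Or.inr (by norm_num))
  rw [Real.zero_rpow (by norm_num)] at h1
  have h2 := ENNReal.tendsto_ofReal h1
  simpa using h2

variable {d : ℕ} [NeZero d] {t : Edge d → Ω → ℝ} {K : ℝ}

/-- The passage time of the segment from `(m, 0, …, 0)` to `(m + k, 0, …, 0)`. -/
noncomputable def segmentTime (t : Edge d → Ω → ℝ) (m k : ℕ) (ω : Ω) : ℝ :=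
  ∑ i ∈ Finset.range k, t (axisEdge d (m + i)) ω

lemma memLp_segmentTime (h2 : ∀ e, MemLp (t e) 2 P) (m k : ℕ) :
    MemLp (segmentTime t m k) 2 P :=
  memLp_finsetSum (Finset.range k) fun i _ => h2 (axisEdge d (m + i))

lemma integral_segmentTime_sq_le (h2 : ∀ e, MemLp (t e) 2 P)
    (hK : ∀ e, ∫ ω, t e ω ^ 2 ∂P ≤ K) (m k : ℕ) :
    ∫ ω, segmentTime t m k ω ^ 2 ∂P ≤ k ^ 2 * K := by
  calc ∫ ω, segmentTime t m k ω ^ 2 ∂P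
      ≤ ∫ ω, k * ∑ i ∈ Finset.range k, t (axisEdge d (m + i)) ω ^ 2 ∂P := by
        refine integral_mono (memLp_segmentTime h2 m k).integrable_sq
          ((integrable_finsetSum _ fun i _ => (h2 _).integrable_sq).const_mul _) fun ω => ?_
        simpa [segmentTime] using sq_sum_le_card_mul_sum_sq (s := Finset.range k)
          (f := fun i => t (axisEdge d (m + i)) ω)
    _ = k * ∑ i ∈ Finset.range k, ∫ ω, t (axisEdge d (m + i)) ω ^ 2 ∂P := by
        rw [integral_const_mul, integral_finsetSum _ fun i _ => (h2 _).integrable_sq]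
    _ ≤ k * ∑ i ∈ Finset.range k, K := by
        gcongr with i
        exact hK _
    _ = k ^ 2 * K := by
        simp
        ring

lemma memLp_minTime (ht : ∀ e, Measurable (t e)) (h0 : ∀ e ω, 0 ≤ t e ω)
    (h2 : ∀ e, MemLp (t e) 2 P) (n : ℕ) : MemLp (minTime t n) 2 P := by
  have h := memLp_iInf_sum ht h0 h2
    (fun π : (lattice d).Path 0 (axisPoint d n) => walkEdges π.1) (nonempty_path n).some
  simpa only [← minTime_eq_iInf_sum] using h

lemma integral_centredTime_sq (ht : ∀ e, Measurable (t e)) (n : ℕ) :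
    ∫ ω, centredTime P t n ω ^ 2 ∂P = Var[minTime t n; P] / n ^ 2 := by
  rw [variance_eq_integral (measurable_minTime ht n).aemeasurable]
  simp only [centredTime, div_pow, integral_div]

variable [IsProbabilityMeasure P]

lemma integral_le_one_add_of_sq {X : Ω → ℝ} (hX : MemLp X 2 P) (hK : ∫ ω, X ω ^ 2 ∂P ≤ K) :
    ∫ ω, X ω ∂P ≤ 1 + K := by
  calc ∫ ω, X ω ∂P ≤ ∫ ω, (1 + X ω ^ 2) ∂P :=
        integral_mono (hX.integrable one_le_two) ((integrable_const 1).add hX.integrable_sq)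
          fun ω => by nlinarith [sq_nonneg (X ω - 1)]
    _ = 1 + ∫ ω, X ω ^ 2 ∂P := by
        rw [integral_add (integrable_const 1) hX.integrable_sq]
        simp
    _ ≤ 1 + K := by linarith

lemma integral_segmentTime_le (h2 : ∀ e, MemLp (t e) 2 P) (hK : ∀ e, ∫ ω, t e ω ^ 2 ∂P ≤ K)
    (m k : ℕ) : ∫ ω, segmentTime t m k ω ∂P ≤ k * (1 + K) := by
  simp only [segmentTime]
  rw [integral_finsetSum _ fun i _ => (h2 _).integrable one_le_two]
  calc _ ≤ ∑ i ∈ Finset.range k, (1 + K) :=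
        Finset.sum_le_sum fun i _ => integral_le_one_add_of_sq (h2 _) (hK _)
    _ = k * (1 + K) := by rw [Finset.sum_const, Finset.card_range, nsmul_eq_mul]

lemma memLp_centredTime (ht : ∀ e, Measurable (t e)) (h0 : ∀ e ω, 0 ≤ t e ω)
    (h2 : ∀ e, MemLp (t e) 2 P) (n : ℕ) : MemLp (centredTime P t n) 2 P := by
  have h := ((memLp_minTime ht h0 h2 n).sub (memLp_const (∫ ω, minTime t n ω ∂P))).const_mul
    ((n : ℝ)⁻¹)
  refine h.ae_eq (Eventually.of_forall fun ω => ?_)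
  simp [centredTime, div_eq_inv_mul]

theorem linearVariance_of_nonneg (ht : ∀ e, Measurable (t e)) (hindep : iIndepFun t P)
    (h0 : ∀ e ω, 0 ≤ t e ω) (hi : NoMassNearZero P t) (h2 : ∀ e, MemLp (t e) 2 P)
    (hK : ∀ e, ∫ ω, t e ω ^ 2 ∂P ≤ K) : LinearVariance P t := by
  obtain ⟨a, R, ha, hR, hlen⟩ := exists_length_le_walkTime_div_add ht hindep h0 hi
  have hK0 : 0 ≤ K := (integral_nonneg fun ω => sq_nonneg _).trans (hK (axisEdge d 0))
  refine ⟨K * ((1 + K) / a + |∫ ω, R ω ∂P|) + 1, by positivity, fun n hn => ?_⟩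
  obtain ⟨w, hw⟩ := exists_walk_zero_axisPoint (d := d) n
  have hS : Integrable (segmentTime t 0 n) P :=
    (memLp_segmentTime h2 0 n).integrable one_le_two
  -- This bounds the length of every path no slower than the straight one, and has mean O(n).
  have hN : Integrable (fun ω => segmentTime t 0 n ω / a + R ω) P := (hS.div_const a).add hR
  have hvar := variance_iInf_sum_le ht hindep h0 h2 hK hK0
    (fun π : (lattice d).Path 0 (axisPoint d n) => walkEdges π.1) w.toPath hN (by
      filter_upwards [hlen] with ω hω π hπ
      have h1 := hω _ π
      rw [← walkTime_eq_sum (fun e => t e ω) π.2,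
        ← walkTime_eq_sum (fun e => t e ω) w.toPath.2] at hπ
      have h3 := walkTime_toPath_le (fun e => h0 e ω) w
      rw [hw] at h3
      have h4 : walkTime (fun e => t e ω) π.1 ≤ segmentTime t 0 n ω := by
        simpa only [segmentTime, zero_add] using hπ.trans h3
      rw [card_walkEdges π.2]
      have h5 := div_le_div_of_nonneg_right h4 ha.le
      linarith)
  simp only [← minTime_eq_iInf_sum] at hvar
  refine hvar.trans ?_
  rw [integral_add (hS.div_const a) hR, integral_div]
  have hn' : (1 : ℝ) ≤ n := by exact_mod_cast hn
  have h6 := div_le_div_of_nonneg_right (integral_segmentTime_le h2 hK 0 n) ha.le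
  have h7 : ∫ ω, R ω ∂P ≤ n * |∫ ω, R ω ∂P| :=
    (le_abs_self _).trans (le_mul_of_one_le_left (abs_nonneg _) hn')
  have h8 := mul_le_mul_of_nonneg_left (add_le_add h6 h7) hK0
  refine h8.trans ?_
  have h9 : K * (n * (1 + K) / a + n * |∫ ω, R ω ∂P|) =
      K * ((1 + K) / a + |∫ ω, R ω ∂P|) * n := by ring
  rw [h9]
  nlinarith

theorem convergesInLp_two_of_nonneg (ht : ∀ e, Measurable (t e)) (h0 : ∀ e ω, 0 ≤ t e ω)
    (h2 : ∀ e, MemLp (t e) 2 P) (hvar : LinearVariance P t) : ConvergesInLp 2 P t := by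
  obtain ⟨C, hC, hvar⟩ := hvar
  refine ⟨memLp_minTime ht h0 h2, tendsto_eLpNorm_two_of_integral_sq
    (memLp_centredTime ht h0 h2) ?_⟩
  refine squeeze_zero' (Eventually.of_forall fun n => integral_nonneg fun ω => sq_nonneg _)
    ?_ (tendsto_const_div_atTop_nhds_zero_nat C)
  filter_upwards [eventually_ge_atTop 1] with n hn
  have hn' : (0 : ℝ) < n := by exact_mod_cast hn
  rw [integral_centredTime_sq ht, div_le_div_iff₀ (by positivity) hn']
  nlinarith [hvar n hn]

/-- Compare n with the largest square k² ≤ n. Both T_n and its mean move by at most the segment up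
to the next square, of 2k + 1 edges, or its expectation; replacing the denominator n by k² only
increases the bound. -/
lemma abs_centredTime_le (ht : ∀ e, Measurable (t e)) (h0 : ∀ e ω, 0 ≤ t e ω)
    (h2 : ∀ e, MemLp (t e) 2 P) {n : ℕ} (hn : 1 ≤ n) (ω : Ω) :
    |centredTime P t n ω| ≤ |centredTime P t (n.sqrt ^ 2) ω| +
      segmentTime t (n.sqrt ^ 2) (2 * n.sqrt + 1) ω / n.sqrt ^ 2 +
      (∫ ω, segmentTime t (n.sqrt ^ 2) (2 * n.sqrt + 1) ω ∂P) / n.sqrt ^ 2 := by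
  set k := n.sqrt
  have hk1 : 1 ≤ k := Nat.sqrt_pos.2 hn
  have hkn : k ^ 2 ≤ n := Nat.sqrt_le' n
  obtain ⟨r, hr⟩ := Nat.exists_eq_add_of_le hkn
  have hr2 : r ≤ 2 * k + 1 := by
    have := Nat.sqrt_le_add n
    nlinarith
  have hS (ω : Ω) : |minTime t n ω - minTime t (k ^ 2) ω| ≤
      segmentTime t (k ^ 2) (2 * k + 1) ω := by
    rw [hr]
    exact (abs_minTime_sub_le (fun e => h0 e ω) _ _).trans
      (Finset.sum_le_sum_of_subset_of_nonneg (Finset.range_mono hr2) fun i _ _ => h0 _ ω)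
  have hI (m : ℕ) : Integrable (minTime t m) P := (memLp_minTime ht h0 h2 m).integrable one_le_two
  have hE : |∫ ω, minTime t n ω ∂P - ∫ ω, minTime t (k ^ 2) ω ∂P| ≤
      ∫ ω, segmentTime t (k ^ 2) (2 * k + 1) ω ∂P := by
    rw [← integral_sub (hI _) (hI _)]
    exact abs_integral_le_integral_abs.trans (integral_mono ((hI _).sub (hI _)).abs
      ((memLp_segmentTime h2 _ _).integrable one_le_two) hS)
  have hk0 : (0 : ℝ) < (k : ℝ) ^ 2 := by positivity
  have hkn' : (k : ℝ) ^ 2 ≤ n := by exact_mod_cast hkn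
  simp only [centredTime, Nat.cast_pow]
  rw [abs_div, abs_div, abs_of_pos hk0, Nat.abs_cast, ← add_div, ← add_div]
  refine div_le_div₀ ?_ ?_ hk0 hkn'
  · have := (abs_nonneg _).trans (hS ω)
    have := (abs_nonneg _).trans hE
    positivity
  · have h1 := hS ω
    rw [abs_le] at h1 hE
    have h3 := abs_le.1 (le_refl |minTime t (k ^ 2) ω - ∫ ω, minTime t (k ^ 2) ω ∂P|)
    rw [abs_le]
    constructor <;> linarith [h1.1, h1.2, hE.1, hE.2, h3.1, h3.2]

theorem convergesAS_of_nonneg (ht : ∀ e, Measurable (t e)) (h0 : ∀ e ω, 0 ≤ t e ω)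
    (h2 : ∀ e, MemLp (t e) 2 P) (hK : ∀ e, ∫ ω, t e ω ^ 2 ∂P ≤ K) (hvar : LinearVariance P t) :
    ConvergesAS P t := by
  obtain ⟨C, hC, hvar⟩ := hvar
  have hK0 : 0 ≤ K := (integral_nonneg fun ω => sq_nonneg _).trans (hK (axisEdge d 0))
  have hsummable (c : ℝ) : Summable fun k : ℕ => c * (1 / (k : ℝ) ^ 2) :=
    (Real.summable_one_div_nat_pow.2 one_lt_two).mul_left c
  have hU := ae_tendsto_zero_of_summable_integral_sq (P := P)
    (fun k : ℕ => memLp_centredTime ht h0 h2 (k ^ 2)) (c := fun k => C * (1 / (k : ℝ) ^ 2))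
    (fun k => by
      rw [integral_centredTime_sq ht]
      -- At k = 0 both sides vanish, division by zero being zero.
      rcases Nat.eq_zero_or_pos k with rfl | hk
      · simp
      · have := hvar (k ^ 2) (Nat.one_le_pow _ _ hk)
        push_cast at this ⊢
        rw [mul_one_div, div_le_div_iff₀ (by positivity) (by positivity)]
        nlinarith [sq_nonneg (k : ℝ)]) (hsummable C)
  have hV := ae_tendsto_zero_of_summable_integral_sq (P := P)
    (X := fun (k : ℕ) ω => segmentTime t (k ^ 2) (2 * k + 1) ω / (k : ℝ) ^ 2)
    (fun k => by
      simpa only [div_eq_inv_mul] using (memLp_segmentTime h2 _ _).const_mul ((k : ℝ) ^ 2)⁻¹)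
    -- From (2k + 1)² ≤ 9k² for k ≥ 1; the segment is short enough that Cauchy–Schwarz, without
    -- independence, gives a summable bound.
    (c := fun k => (9 * K) * (1 / (k : ℝ) ^ 2))
    (fun k => by
      simp only [div_pow, integral_div]
      rcases Nat.eq_zero_or_pos k with rfl | hk
      · simp
      · have h1 := integral_segmentTime_sq_le h2 hK (k ^ 2) (2 * k + 1)
        have hk' : (1 : ℝ) ≤ k := by exact_mod_cast hk
        rw [mul_one_div, div_le_div_iff₀ (by positivity) (by positivity)]
        push_cast at h1
        have h3 : (2 * (k : ℝ) + 1) ^ 2 * K ≤ 9 * K * k ^ 2 := by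
          have : (2 * (k : ℝ) + 1) ^ 2 ≤ 9 * k ^ 2 := by nlinarith
          nlinarith
        calc _ ≤ 9 * K * (k : ℝ) ^ 2 * k ^ 2 :=
              mul_le_mul_of_nonneg_right (h1.trans h3) (by positivity)
          _ = _ := by ring) (hsummable (9 * K))
  have hW : Tendsto (fun k : ℕ => (∫ ω, segmentTime t (k ^ 2) (2 * k + 1) ω ∂P) / (k : ℝ) ^ 2)
      atTop (𝓝 0) := by
    refine squeeze_zero' (Eventually.of_forall fun k => div_nonneg (integral_nonneg fun ω =>
      Finset.sum_nonneg fun i _ => h0 _ ω) (by positivity)) ?_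
      (tendsto_const_div_atTop_nhds_zero_nat (3 * (1 + K)))
    filter_upwards [eventually_ge_atTop 1] with k hk
    have h1 := integral_segmentTime_le h2 hK (k ^ 2) (2 * k + 1)
    have hk' : (1 : ℝ) ≤ k := by exact_mod_cast hk
    rw [div_le_div_iff₀ (by positivity) (by positivity)]
    push_cast at h1
    have h3 : (2 * (k : ℝ) + 1) * (1 + K) ≤ 3 * (1 + K) * k := by nlinarith
    calc _ ≤ 3 * (1 + K) * (k : ℝ) * k := mul_le_mul_of_nonneg_right (h1.trans h3) (by positivity)
      _ = _ := by ring
  have hsqrt : Tendsto Nat.sqrt atTop atTop := by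
    refine tendsto_atTop_atTop.2 fun b => ⟨b ^ 2, fun n hn => Nat.le_sqrt'.2 hn⟩
  filter_upwards [hU, hV] with ω hUω hVω
  have hlim := ((hUω.abs.add hVω).add hW).comp hsqrt
  simp only [abs_zero, add_zero] at hlim
  refine squeeze_zero_norm' ?_ hlim
  filter_upwards [eventually_ge_atTop 1] with n hn
  exact abs_centredTime_le ht h0 h2 hn ω

theorem nontrivialGrowth_of_nonneg (ht : ∀ e, Measurable (t e)) (hindep : iIndepFun t P)
    (h0 : ∀ e ω, 0 ≤ t e ω) (hi : NoMassNearZero P t) (h2 : ∀ e, MemLp (t e) 2 P)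
    (hK : ∀ e, ∫ ω, t e ω ^ 2 ∂P ≤ K) (has : ConvergesAS P t) : NontrivialGrowth P t := by
  obtain ⟨a, R, ha, -, hlen⟩ := exists_length_le_walkTime_div_add ht hindep h0 hi
  -- Paths to the target have length at least n, so T_n ≥ a(n − R); above, E T_n ≤ n(1 + K). The
  -- maximum only secures η₁ ≤ η₂.
  refine ⟨a, max a (1 + K), ha, le_max_left _ _, ?_⟩
  filter_upwards [hlen, has] with ω hω hconv
  refine ⟨?_, liminf_le_limsup, ?_⟩
  · have hlow : Tendsto (fun n : ℕ => ((a - a * R ω / n : ℝ) : EReal)) atTop (𝓝 (a : EReal)) := by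
      refine (continuous_coe_real_ereal.tendsto a).comp ?_
      simpa using tendsto_const_nhds.sub (tendsto_const_div_atTop_nhds_zero_nat (a * R ω))
    rw [← hlow.liminf_eq]
    refine liminf_le_liminf ?_
    filter_upwards [eventually_ge_atTop 1] with n hn
    have hn' : (0 : ℝ) < n := by exact_mod_cast hn
    have := nonempty_path (d := d) n
    have hT : a * (n - R ω) ≤ minTime t n ω := by
      refine le_ciInf fun π => ?_
      have h1 := hω _ π
      have h3 : (n : ℝ) ≤ π.1.length := by exact_mod_cast le_length_of_walk_axisPoint π.1
      have h4 : n - R ω ≤ walkTime (fun e => t e ω) π.1 / a := by linarith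
      rw [le_div_iff₀ ha] at h4
      linarith
    rw [EReal.coe_le_coe_iff, le_div_iff₀ hn', sub_mul, div_mul_cancel₀ _ hn'.ne']
    linarith
  · have hup : Tendsto (fun n : ℕ => ((centredTime P t n ω + (1 + K) : ℝ) : EReal)) atTop
        (𝓝 ((1 + K : ℝ) : EReal)) := by
      refine (continuous_coe_real_ereal.tendsto (1 + K)).comp ?_
      simpa using hconv.add_const (1 + K)
    refine le_trans ?_ (EReal.coe_le_coe_iff.2 (le_max_right a (1 + K)))
    rw [← hup.limsup_eq]
    refine limsup_le_limsup ?_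
    filter_upwards [eventually_ge_atTop 1] with n hn
    have hn' : (0 : ℝ) < n := by exact_mod_cast hn
    have hE : ∫ ω, minTime t n ω ∂P ≤ n * (1 + K) := by
      refine le_trans (integral_mono ((memLp_minTime ht h0 h2 n).integrable one_le_two)
        ((memLp_segmentTime h2 0 n).integrable one_le_two) fun ω => ?_)
        (integral_segmentTime_le h2 hK 0 n)
      simpa only [segmentTime, zero_add] using minTime_le_sum_axisEdge (fun e => h0 e ω) n
    rw [EReal.coe_le_coe_iff, centredTime, div_add' _ _ _ hn'.ne']
    exact div_le_div_of_nonneg_right (by linarith) hn'.le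

end NonnegativeTimes

/-! ### Reduction to nonnegative times and bounded second moments -/

section Reduction

variable {d : ℕ} {Ω : Type*} [MeasurableSpace Ω] {P : Measure Ω} {t t' : Edge d → Ω → ℝ}

lemma NoMassNearZero.ae_nonneg (hi : NoMassNearZero P t) : ∀ᵐ ω ∂P, ∀ e, 0 ≤ t e ω := by
  refine ae_all_iff.2 fun e => ?_
  have hle : P {ω | t e ω < 0} ≤ 0 := by
    refine ge_of_tendsto hi ?_
    filter_upwards [self_mem_nhdsWithin] with ε (hε : 0 < ε)
    refine le_trans (measure_mono fun ω hω => ?_) (le_iSup (fun e => P {ω | t e ω < ε}) e)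
    exact lt_trans hω hε
  rw [ae_iff]
  simpa only [not_le] using nonpos_iff_eq_zero.1 hle

lemma NoMassNearZero.abs (hi : NoMassNearZero P t) : NoMassNearZero P fun e ω => |t e ω| := by
  refine tendsto_of_tendsto_of_tendsto_of_le_of_le tendsto_const_nhds hi (fun _ => zero_le)
    fun ε => iSup_mono fun e => measure_mono fun ω (hω : |t e ω| < ε) => ?_
  exact (le_abs_self (t e ω)).trans_lt hω

lemma BoundedSecondMoments.exists_bound (ht : ∀ e, Measurable (t e))
    (h : BoundedSecondMoments P t) :
    (∀ e, MemLp (t e) 2 P) ∧ ∃ K : ℝ, ∀ e, ∫ ω, t e ω ^ 2 ∂P ≤ K := by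
  have hle (e : Edge d) := le_iSup (fun e => ∫⁻ ω, ENNReal.ofReal (t e ω ^ 2) ∂P) e
  have hL (e : Edge d) : MemLp (t e) 2 P := by
    rw [memLp_two_iff_integrable_sq (ht e).aestronglyMeasurable]
    refine ⟨((ht e).pow_const 2).aestronglyMeasurable, ?_⟩
    rw [hasFiniteIntegral_iff_ofReal (Eventually.of_forall fun ω => sq_nonneg _)]
    exact (hle e).trans_lt h
  refine ⟨hL, (⨆ e, ∫⁻ ω, ENNReal.ofReal (t e ω ^ 2) ∂P).toReal, fun e => ?_⟩
  rw [integral_eq_lintegral_of_nonneg_ae (Eventually.of_forall fun ω => sq_nonneg _)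
    ((ht e).pow_const 2).aestronglyMeasurable]
  exact ENNReal.toReal_mono h.ne (hle e)

/-- Cut at a level M where the tail contributes at most 1. Below M the square is at most M² only
because times are almost surely nonnegative. -/
lemma UnifIntegrableSquares.boundedSecondMoments [IsProbabilityMeasure P]
    (ht : ∀ e, Measurable (t e)) (hi : NoMassNearZero P t) (h : UnifIntegrableSquares P t) :
    BoundedSecondMoments P t := by
  obtain ⟨M, hM, hM0⟩ := ((h.eventually_lt_const (zero_lt_one (α := ℝ≥0∞))).and
    (eventually_ge_atTop 0)).exists
  refine (iSup_le fun e => ?_).trans_lt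
    (ENNReal.add_lt_top.2 ⟨ENNReal.one_lt_top, ENNReal.ofReal_lt_top (r := M ^ 2)⟩)
  have h1 : ∫⁻ ω in {ω | M ≤ t e ω}, ENNReal.ofReal (t e ω ^ 2) ∂P ≤ 1 :=
    (le_iSup (fun e => ∫⁻ ω in {ω | M ≤ t e ω}, ENNReal.ofReal (t e ω ^ 2) ∂P) e).trans hM.le
  have h2 : ∫⁻ ω in {ω | M ≤ t e ω}ᶜ, ENNReal.ofReal (t e ω ^ 2) ∂P ≤ ENNReal.ofReal (M ^ 2) := by
    calc _ ≤ ∫⁻ ω in {ω | M ≤ t e ω}ᶜ, ENNReal.ofReal (M ^ 2) ∂P := by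
          refine lintegral_mono_ae ?_
          filter_upwards [ae_restrict_of_ae hi.ae_nonneg, ae_restrict_mem
            (measurableSet_le measurable_const (ht e)).compl] with ω h0 hlt
          refine ENNReal.ofReal_le_ofReal (pow_le_pow_left₀ (h0 e) ?_ 2)
          exact (lt_of_not_ge fun h => hlt h).le
      _ ≤ ENNReal.ofReal (M ^ 2) := by
          rw [setLIntegral_const]
          exact mul_le_of_le_one_right zero_le prob_le_one
  calc ∫⁻ ω, ENNReal.ofReal (t e ω ^ 2) ∂P
      = ∫⁻ ω in {ω | M ≤ t e ω} ∪ {ω | M ≤ t e ω}ᶜ, ENNReal.ofReal (t e ω ^ 2) ∂P := by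
        rw [Set.union_compl_self, setLIntegral_univ]
    _ ≤ _ := (lintegral_union_le _ _ _).trans (add_le_add h1 h2)

lemma BoundedHigherMoments.boundedSecondMoments [IsProbabilityMeasure P]
    (hi : NoMassNearZero P t) (h : BoundedHigherMoments P t) : BoundedSecondMoments P t := by
  obtain ⟨p, hp, h⟩ := h
  refine (iSup_le fun e => ?_).trans_lt (ENNReal.add_lt_top.2 ⟨ENNReal.one_lt_top, h⟩)
  calc ∫⁻ ω, ENNReal.ofReal (t e ω ^ 2) ∂P
      ≤ ∫⁻ ω, (1 + ENNReal.ofReal (t e ω ^ p)) ∂P := by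
        refine lintegral_mono_ae ?_
        filter_upwards [hi.ae_nonneg] with ω hω
        rw [← ENNReal.ofReal_one, ← ENNReal.ofReal_add zero_le_one (Real.rpow_nonneg (hω e) p)]
        refine ENNReal.ofReal_le_ofReal ?_
        rcases le_total (t e ω) 1 with h1 | h1
        · nlinarith [hω e, Real.rpow_nonneg (hω e) p]
        · have := Real.rpow_le_rpow_of_exponent_le h1 hp.le
          rw [Real.rpow_two] at this
          linarith
    _ = 1 + ∫⁻ ω, ENNReal.ofReal (t e ω ^ p) ∂P := by
        rw [lintegral_add_left measurable_const]
        simp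
    _ ≤ _ := add_le_add le_rfl
        (le_iSup (fun e => ∫⁻ ω, ENNReal.ofReal (t e ω ^ p) ∂P) e)

variable [NeZero d]

lemma ae_centredTime_eq (h : ∀ᵐ ω ∂P, ∀ n, minTime t n ω = minTime t' n ω) :
    ∀ᵐ ω ∂P, ∀ n, centredTime P t n ω = centredTime P t' n ω := by
  filter_upwards [h] with ω hω n
  rw [centredTime, centredTime, hω n, integral_congr_ae (h.mono fun ω hω => hω n)]

lemma ConvergesAS.congr (h : ∀ᵐ ω ∂P, ∀ n, minTime t n ω = minTime t' n ω)
    (ht : ConvergesAS P t) : ConvergesAS P t' := by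
  filter_upwards [ht, ae_centredTime_eq h] with ω h1 h2
  simpa only [h2] using h1

lemma ConvergesInLp.congr {q : ℝ≥0∞} (h : ∀ᵐ ω ∂P, ∀ n, minTime t n ω = minTime t' n ω)
    (ht : ConvergesInLp q P t) : ConvergesInLp q P t' := by
  refine ⟨fun n => (ht.1 n).ae_eq (h.mono fun ω hω => hω n), ?_⟩
  refine ht.2.congr fun n => eLpNorm_congr_ae ?_
  exact (ae_centredTime_eq h).mono fun ω hω => hω n

lemma NontrivialGrowth.congr (h : ∀ᵐ ω ∂P, ∀ n, minTime t n ω = minTime t' n ω)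
    (ht : NontrivialGrowth P t) : NontrivialGrowth P t' := by
  obtain ⟨η₁, η₂, h1, h2, h3⟩ := ht
  refine ⟨η₁, η₂, h1, h2, ?_⟩
  filter_upwards [h3, h] with ω h4 h5
  simpa only [h5] using h4

lemma LinearVariance.congr (h : ∀ᵐ ω ∂P, ∀ n, minTime t n ω = minTime t' n ω)
    (ht : LinearVariance P t) : LinearVariance P t' := by
  obtain ⟨C, hC, h1⟩ := ht
  exact ⟨C, hC, fun n hn => (variance_congr (h.mono fun ω hω => hω n)).symm.trans_le (h1 n hn)⟩

variable [IsProbabilityMeasure P]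

lemma ConvergesInLp.one (ht : ∀ e, Measurable (t e)) (h : ConvergesInLp 2 P t) :
    ConvergesInLp 1 P t := by
  refine ⟨fun n => (h.1 n).mono_exponent one_le_two, ?_⟩
  refine tendsto_of_tendsto_of_tendsto_of_le_of_le tendsto_const_nhds h.2 (fun _ => zero_le)
    fun n => eLpNorm_le_eLpNorm_of_exponent_le one_le_two ?_
  exact (((measurable_minTime ht n).sub_const _).div_const _).aestronglyMeasurable

/-- Bounded second moments suffice for all conclusions, including the linear bound on the
variance. -/
theorem conclusions_of_boundedSecondMoments (ht : ∀ e, Measurable (t e))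
    (hindep : iIndepFun t P) (hi : NoMassNearZero P t) (h : BoundedSecondMoments P t) :
    ConvergesAS P t ∧ ConvergesInLp 2 P t ∧ LinearVariance P t ∧ NontrivialGrowth P t := by
  -- Absolute values make the times nonnegative everywhere and change no T_n outside a single null
  -- set.
  have htime : ∀ᵐ ω ∂P, ∀ n, minTime (fun e ω => |t e ω|) n ω = minTime t n ω := by
    filter_upwards [hi.ae_nonneg] with ω hω n
    simp only [minTime, fun e => abs_of_nonneg (hω e)]
  have ht' (e : Edge d) : Measurable fun ω => |t e ω| := (ht e).abs
  have hindep' : iIndepFun (fun e ω => |t e ω|) P :=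
    hindep.comp (fun _ x => |x|) fun _ => measurable_id.abs
  have h0 (e : Edge d) (ω : Ω) : 0 ≤ |t e ω| := abs_nonneg _
  have h' : BoundedSecondMoments P fun e ω => |t e ω| := by
    simpa only [BoundedSecondMoments, sq_abs] using h
  obtain ⟨h2, K, hK⟩ := h'.exists_bound ht'
  have hvar := linearVariance_of_nonneg ht' hindep' h0 hi.abs h2 hK
  have has := convergesAS_of_nonneg ht' h0 h2 hK hvar
  exact ⟨has.congr htime, (convergesInLp_two_of_nonneg ht' h0 h2 hvar).congr htime,
    hvar.congr htime,
    (nontrivialGrowth_of_nonneg ht' hindep' h0 hi.abs h2 hK has).congr htime⟩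

end Reduction

end FPP

theorem theorem1 {d : ℕ} [NeZero d] {Ω : Type*} [MeasurableSpace Ω] (P : Measure Ω)
    [IsProbabilityMeasure P] (t : FPP.Edge d → Ω → ℝ) (ht : ∀ e, Measurable (t e))
    (hindep : iIndepFun t P) (hi : FPP.NoMassNearZero P t) :
    (FPP.BoundedSecondMoments P t →
      FPP.ConvergesAS P t ∧ FPP.ConvergesInLp 1 P t ∧ FPP.NontrivialGrowth P t) ∧
    (FPP.UnifIntegrableSquares P t →
      FPP.ConvergesAS P t ∧ FPP.ConvergesInLp 2 P t ∧ FPP.NontrivialGrowth P t) ∧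
    (FPP.BoundedHigherMoments P t →
      FPP.ConvergesAS P t ∧ FPP.ConvergesInLp 2 P t ∧ FPP.LinearVariance P t ∧
        FPP.NontrivialGrowth P t) := by
  refine ⟨fun h => ?_, fun h => ?_, fun h => ?_⟩
  · obtain ⟨has, hLp, -, hgrowth⟩ := FPP.conclusions_of_boundedSecondMoments ht hindep hi h
    exact ⟨has, hLp.one ht, hgrowth⟩
  · obtain ⟨has, hLp, -, hgrowth⟩ := FPP.conclusions_of_boundedSecondMoments ht hindep hi
      (h.boundedSecondMoments ht hi)
    exact ⟨has, hLp, hgrowth⟩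
  · exact FPP.conclusions_of_boundedSecondMoments ht hindep hi (h.boundedSecondMoments hi)
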